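/- Let $M^2$ be a smooth surface and $\mathbf g : M^2 \to \mathbb S^5 \subset \mathbb R^6$ a smooth minimal immersion whose second fundamental form $B$ vanishes at no point, i.e. $B_p \neq 0$ for every $p \in M$. Let $$\mathcal N=\{(p,V)\in M\times\mathbb R^6 : \|V\|=1,\ V\perp \mathbb R\,\mathbf g(p)\oplus \mathbf g_*(T_pM)\}$$ be the unit normal bundle of $\mathbf g$ in $\mathbb S^5$, and let $$\mathcal N_*=\{(p,V)\in\mathcal N : \langle V, B_p(X,Y)\rangle\neq 0 \text{ for some } X,Y\in T_pM\},$$ that is, from each fibre of $\mathcal N$ the unit normals orthogonal to the image of $B_p$ are removed. Then $\mathcal N_*$ is open in $\mathcal N$ and is a smooth $4$-dimensional embedded submanifold of $M\times\mathbb R^6$, and the map $$\mathbf x_{\mathbf g}:\mathcal N_*\to\mathbb S^5,\qquad \mathbf x_{\mathbf g}(p,V)=V,$$ is an immersion. Moreover $\mathbf x_{\mathbf g}$ is a minimal immersed hypersurface of $\mathbb S^5$ whose Gauss–Kronecker curvature $H_4=\lambda_1\lambda_2\lambda_3\lambda_4$ and $3$-mean curvature $H_3=\frac14\sum_{i<j<k}\lambda_i\lambda_j\lambda_k$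 vanish identically, where $\lambda_1,\dots,\lambda_4$ are the principal curvatures of $\mathbf x_{\mathbf g}$ with respect to a unit normal vector (tangent to $\mathbb S^5$). -/

import Mathlib

open scoped Manifold ContDiff InnerProductSpace

noncomputable section

/-- Euclidean space `ℝ⁶`. -/
abbrev E6 : Type := EuclideanSpace ℝ (Fin 6)

/-- The unit sphere `S⁵ ⊂ ℝ⁶`, with Mathlib's manifold structure. -/
abbrev S5 : Type := Metric.sphere (0 : E6) 1

namespace SphereImmersion

section General

variable (n : ℕ) {M : Type*} [TopologicalSpace M] [ChartedSpace (EuclideanSpace ℝ (Fin n)) M]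

/-- The differential `df_p : T_pM → ℝ⁶` of `f : M → S⁵ ⊂ ℝ⁶`. -/
def differential (f : M → S5) (p : M) : TangentSpace (𝓡 n) p →L[ℝ] E6 :=
  mfderiv (𝓡 n) 𝓘(ℝ, E6) (fun x => (f x : E6)) p

/-- The normal space `(f_* T_pM)^⊥` of `f` in `S⁵` at `p`: the vectors of `ℝ⁶` that are tangent
to `S⁵` at `f p` and orthogonal to `df_p(T_pM)`. -/
def normalSpace (f : M → S5) (p : M) : Submodule ℝ E6 :=
  ((ℝ ∙ (f p : E6)) ⊔ (differential n f p).range)ᗮ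

/-- The second fundamental form `B_p(X, Y)` of `f : M → S⁵`: the component in `normalSpace n f p`
of the derivative along `X` of `df(Y)`, where `Y` is extended to a vector field with constant
coordinates in the preferred chart at `p` (the chart through which Mathlib identifies `T_pM` with
`ℝⁿ`).  The normal component does not depend on the extension. -/
def secondFundamentalForm (f : M → S5) (p : M) (X Y : TangentSpace (𝓡 n) p) : E6 :=
  (normalSpace n f p).starProjection
    (fderiv ℝ (fderiv ℝ (fun u : EuclideanSpace ℝ (Fin n) =>
      (f ((extChartAt (𝓡 n) p).symm u) : E6))) (extChartAt (𝓡 n) p p) X Y)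

/-- The `i`-th coordinate vector of `T_pM` in the preferred chart at `p`. -/
def coordVec (p : M) (i : Fin n) : TangentSpace (𝓡 n) p :=
  (EuclideanSpace.single i (1 : ℝ) : EuclideanSpace ℝ (Fin n))

/-- The matrix of the first fundamental form (the induced metric) in the coordinate basis. -/
def firstFormMatrix (f : M → S5) (p : M) : Matrix (Fin n) (Fin n) ℝ :=
  Matrix.of fun i j =>
    ⟪differential n f p (coordVec n p i), differential n f p (coordVec n p j)⟫_ℝ

/-- The mean curvature vector `(1/n) tr B_p`, the trace being taken with respect to the induced
metric. -/
def meanCurvatureVector (f : M → S5) (p : M) : E6 :=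
  (1 / (n : ℝ)) • ∑ i, ∑ j,
    (firstFormMatrix n f p)⁻¹ i j • secondFundamentalForm n f p (coordVec n p i) (coordVec n p j)

/-- A minimal immersion `f : M → S⁵`: a smooth immersion whose mean curvature vanishes
identically. -/
def IsMinimalImmersion (f : M → S5) : Prop :=
  Manifold.IsImmersion (𝓡 n) (𝓡 5) ∞ f ∧ ∀ p, meanCurvatureVector n f p = 0

/-- The matrix in the coordinate basis of the shape operator of `f` at `p` in the normal
direction `ν`, that is, of the endomorphism `A` of `T_pM` with
`⟪df_p(A X), df_p(Y)⟫ = ⟪B_p(X, Y), ν⟫`. -/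
def shapeMatrix (f : M → S5) (p : M) (ν : E6) : Matrix (Fin n) (Fin n) ℝ :=
  (firstFormMatrix n f p)⁻¹ * Matrix.of fun i j =>
    ⟪secondFundamentalForm n f p (coordVec n p i) (coordVec n p j), ν⟫_ℝ

/-- The principal curvatures of `f` at `p` in the direction `ν`: the eigenvalues of the shape
operator, with multiplicity. -/
def principalCurvatures (f : M → S5) (p : M) (ν : E6) : Multiset ℝ :=
  (shapeMatrix n f p ν).charpoly.roots

/-- The `r`-mean curvature `H_r = C(n, r)⁻¹ ∑_{i₁ < ⋯ < i_r} λ_{i₁} ⋯ λ_{i_r}` of `f` at `p` with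
respect to the unit normal `ν`. -/
def rMeanCurvature (r : ℕ) (f : M → S5) (p : M) (ν : E6) : ℝ :=
  (principalCurvatures n f p ν).esymm r / (n.choose r : ℝ)

/-- The Gauss–Kronecker curvature: the product `H_n` of the principal curvatures. -/
def gaussKroneckerCurvature (f : M → S5) (p : M) (ν : E6) : ℝ :=
  rMeanCurvature n n f p ν

end General

section Surface

variable {M : Type*} [TopologicalSpace M] [ChartedSpace (EuclideanSpace ℝ (Fin 2)) M]

/-- The unit normal bundle `N ⊂ M × ℝ⁶` of `g : M² → S⁵`. -/
def unitNormalBundle (g : M → S5) : Set (M × E6) :=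
  {q | ‖q.2‖ = 1 ∧ q.2 ∈ normalSpace 2 g q.1}

/-- The linear span of the image of the second fundamental form at `p`. -/
def secondFormImage (g : M → S5) (p : M) : Submodule ℝ E6 :=
  Submodule.span ℝ {w | ∃ X Y : TangentSpace (𝓡 2) p, w = secondFundamentalForm 2 g p X Y}

/-- The subset `N_*` of the unit normal bundle: from each fibre, the unit normals orthogonal to the
image of the second fundamental form are removed. -/
def starBundle (g : M → S5) : Set (M × E6) :=
  {q | q ∈ unitNormalBundle g ∧ q.2 ∉ (secondFormImage g q.1)ᗮ}

/-- The map `x_g : N_* → S⁵`, `x_g(p, V) = V`. -/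
def polarMap (g : M → S5) (q : starBundle g) : S5 :=
  ⟨q.1.2, mem_sphere_zero_iff_norm.2 q.2.1.1⟩

end Surface

end SphereImmersion

end

open SphereImmersion

/-!
In local coordinates let `G` be the surface and `V` a family of unit normals of `G` in the sphere,
`π` being the projection of the parameters of `V` to those of `G`.  Differentiating `⟪V, G⟫ = 0` and
`⟪V, dG⟫ = 0` gives `⟪dV, G⟫ = 0` and `⟪dV, dG⟫ = -π^*H`, where `H = ⟪V, d²G⟫` is the second
fundamental form of `G` in the direction `V`.  Being symmetric, trace-free with respect to the
induced metric and not zero, `H` is nondegenerate in dimension two; hence `V` is an immersion as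
soon as the coordinates on the fibres of the normal bundle move `V`, its normal line in the sphere
is spanned by `G`, and its second fundamental form in the direction `G` is the pullback `π^*H`.
This form has rank two, so all elementary symmetric functions of degree at least three of the
principal curvatures vanish.  Its trace with respect to the metric induced by `V` is the trace of
the inverse of the shape operator of `G`, hence zero: in dimension two the inverse of a trace-free
endomorphism is trace-free.
-/

open Set Function Topology

section Immersion

variable {E E' F : Type*} [NormedAddCommGroup E] [NormedSpace ℝ E]
  [NormedAddCommGroup E'] [NormedSpace ℝ E'] [NormedAddCommGroup F] [NormedSpace ℝ F]
  {H H' : Type*} [TopologicalSpace H] [TopologicalSpace H']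
  {I : ModelWithCorners ℝ E H} {J : ModelWithCorners ℝ E' H'}
  {M N : Type*} [TopologicalSpace M] [ChartedSpace H M] [TopologicalSpace N] [ChartedSpace H' N]
  {n : ℕ∞ω} {f : M → N} {x : M}

theorem injective_mfderiv_extend {φ : OpenPartialHomeomorph M H}
    (hφ : φ ∈ IsManifold.maximalAtlas I 1 M) (hx : x ∈ φ.source) :
    Injective (mfderiv I 𝓘(ℝ, E) (φ.extend I) x) := by
  have hd : φ.MDifferentiable I I :=
    ⟨(contMDiffOn_of_mem_maximalAtlas hφ).mdifferentiableOn one_ne_zero,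
      (contMDiffOn_symm_of_mem_maximalAtlas hφ).mdifferentiableOn one_ne_zero⟩
  have hcomp : mfderiv I 𝓘(ℝ, E) (φ.extend I) x
      = (mfderiv I 𝓘(ℝ, E) I (φ x)).comp (mfderiv I I φ x) :=
    mfderiv_comp x I.mdifferentiableAt (hd.mdifferentiableAt hx)
  rw [hcomp, I.hasMFDerivAt.mfderiv]
  exact hd.mfderiv_injective hx

theorem injective_mfderiv_of_isImmersionAt (hn : n ≠ 0) (h : Manifold.IsImmersionAt I J n f x) :
    Injective (mfderiv I J f x) := by
  have hn1 : 1 ≤ n := ENat.one_le_iff_ne_zero_withTop.2 hn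
  let r : E' →L[ℝ] E :=
    (ContinuousLinearMap.fst ℝ E h.complement).comp (h.equiv.symm : E' →L[ℝ] E × h.complement)
  have hleft : (r ∘ h.codChart.extend J) ∘ f =ᶠ[𝓝 x] h.domChart.extend I := by
    filter_upwards [h.domChart.open_source.mem_nhds h.mem_domChart_source] with y hy
    have hy' : y ∈ (h.domChart.extend I).source := by simpa using hy
    have hwritten := h.writtenInCharts ((h.domChart.extend I).map_source hy')
    simp only [comp_apply, (h.domChart.extend I).left_inv hy'] at hwritten
    simp only [comp_apply, hwritten, r]
    simp
  have hcod : MDifferentiableAt J 𝓘(ℝ, E) (r ∘ h.codChart.extend J) (f x) :=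
    r.mdifferentiableAt.comp _ ((h.codChart.contMDiffAt_extend h.codChart_mem_maximalAtlas
      h.mem_codChart_source).mdifferentiableAt hn)
  have hderiv := hleft.mfderiv_eq (I := I) (I' := 𝓘(ℝ, E))
  rw [mfderiv_comp x hcod (h.contMDiffAt.mdifferentiableAt hn)] at hderiv
  refine Injective.of_comp (f := mfderiv J 𝓘(ℝ, E) (r ∘ h.codChart.extend J) (f x)) ?_
  rw [← ContinuousLinearMap.coe_comp, hderiv]
  exact injective_mfderiv_extend (IsManifold.maximalAtlas_subset_of_le hn1
    h.domChart_mem_maximalAtlas) h.mem_domChart_source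

theorem exists_openPartialHomeomorph_contDiffOn_symm [CompleteSpace E] {Φ : E → F} {U : Set E}
    {a : E} (hU : IsOpen U) (hΦ : ContDiffOn ℝ n Φ U) (hn : n ≠ 0) (ha : a ∈ U)
    (hinv : (fderiv ℝ Φ a).IsInvertible) :
    ∃ P : OpenPartialHomeomorph E F, ⇑P = Φ ∧ a ∈ P.source ∧ P.source ⊆ U ∧
      ContDiffOn ℝ n P.symm P.target := by
  obtain ⟨e, he⟩ := hinv
  have hda : HasFDerivAt Φ (e : E →L[ℝ] F) a :=
    he ▸ ((hΦ.contDiffAt (hU.mem_nhds ha)).differentiableAt hn).hasFDerivAt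
  have hca : ContDiffAt ℝ n Φ a := hΦ.contDiffAt (hU.mem_nhds ha)
  let S : Set E := U ∩ fderiv ℝ Φ ⁻¹' range ((↑) : (E ≃L[ℝ] F) → E →L[ℝ] F)
  have hS : IsOpen S :=
    (hΦ.continuousOn_fderiv_of_isOpen hU
      (ENat.one_le_iff_ne_zero_withTop.2 hn)).isOpen_inter_preimage
      hU ContinuousLinearEquiv.isOpen
  let P := (hca.toOpenPartialHomeomorph Φ hda hn).restr S
  have hPS : P.source ⊆ S := by simp [P, hS.interior_eq]
  refine ⟨P, rfl, ?_, fun p hp => (hPS hp).1, fun y hy => ?_⟩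
  · rw [OpenPartialHomeomorph.restr_source, hS.interior_eq]
    exact ⟨hca.mem_toOpenPartialHomeomorph_source hda hn, ha, e, he⟩
  · obtain ⟨hU', e', he'⟩ := hPS (P.map_target hy)
    have hc : ContDiffAt ℝ n Φ (P.symm y) := hΦ.contDiffAt (hU.mem_nhds hU')
    exact (P.contDiffAt_symm (f₀' := e') hy (he' ▸ (hc.differentiableAt hn).hasFDerivAt)
      hc).contDiffWithinAt

theorem exists_equiv_prod_extending [FiniteDimensional ℝ E] [FiniteDimensional ℝ E']
    [FiniteDimensional ℝ F] (L : E →L[ℝ] E') (hL : Injective L)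
    (hF : Module.finrank ℝ E + Module.finrank ℝ F = Module.finrank ℝ E') :
    ∃ e : (E × F) ≃L[ℝ] E', ∀ v, e (v, 0) = L v := by
  obtain ⟨Q, hQ⟩ := Submodule.exists_isCompl (L : E →ₗ[ℝ] E').range
  have hrange : Module.finrank ℝ (L : E →ₗ[ℝ] E').range = Module.finrank ℝ E :=
    LinearMap.finrank_range_of_inj hL
  have hcompl := Submodule.finrank_add_eq_of_isCompl hQ
  let e : (E × F) ≃ₗ[ℝ] E' :=
    ((LinearEquiv.ofInjective (L : E →ₗ[ℝ] E') hL).prodCongr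
      (LinearEquiv.ofFinrankEq F Q (by lia))).trans (Submodule.prodEquivOfIsCompl _ _ hQ)
  exact ⟨e.toContinuousLinearEquiv, fun v => by simp [e]⟩

theorem exists_straightening [FiniteDimensional ℝ E] [FiniteDimensional ℝ E']
    [FiniteDimensional ℝ F] {h : E → E'} {U : Set E} {a : E} (hU : IsOpen U) (ha : a ∈ U)
    (hn : n ≠ 0) (hh : ContDiffOn ℝ n h U) (hinj : Injective (fderiv ℝ h a))
    (hF : Module.finrank ℝ E + Module.finrank ℝ F = Module.finrank ℝ E') :
    ∃ (Θ : OpenPartialHomeomorph E' E') (e : (E × F) ≃L[ℝ] E') (V : Set E),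
      IsOpen V ∧ a ∈ V ∧ ContDiffOn ℝ n Θ Θ.source ∧ ContDiffOn ℝ n Θ.symm Θ.target ∧
      ∀ u ∈ V, h u ∈ Θ.source ∧ Θ (h u) = e (u, 0) := by
  obtain ⟨e, he⟩ := exists_equiv_prod_extending (F := F) (fderiv ℝ h a) hinj hF
  let Φ : E × F → E' := fun p => h p.1 + e (0, p.2)
  have hΦ : ContDiffOn ℝ n Φ (U ×ˢ univ) :=
    (hh.comp contDiff_fst.contDiffOn fun p hp => hp.1).add (by fun_prop)
  have hderiv : HasFDerivAt Φ (e : E × F →L[ℝ] E') (a, 0) := by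
    have hh' : HasFDerivAt h (fderiv ℝ h a) ((a, (0 : F)).1) :=
      ((hh.contDiffAt (hU.mem_nhds ha)).differentiableAt hn).hasFDerivAt
    have he' := ((e : E × F →L[ℝ] E').comp (.inr ℝ E F)).hasFDerivAt (x := (a, (0 : F)).2)
    refine ((hh'.comp (a, (0 : F)) hasFDerivAt_fst).add
      (he'.comp (a, (0 : F)) hasFDerivAt_snd)).congr_fderiv ?_
    ext p <;> simp [he]
  obtain ⟨P, hP, haP, hPU, hPsymm⟩ := exists_openPartialHomeomorph_contDiffOn_symm
    (hU.prod isOpen_univ) hΦ hn (mk_mem_prod ha (mem_univ 0)) ⟨e, hderiv.fderiv.symm⟩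
  have hP0 : ∀ u, P (u, 0) = h u := fun u => by
    rw [hP]; change h u + e 0 = h u; rw [map_zero, add_zero]
  refine ⟨P.symm.trans e.toHomeomorph.toOpenPartialHomeomorph, e,
    (fun u => ((u, 0) : E × F)) ⁻¹' P.source, P.open_source.preimage (by fun_prop), haP,
    ?_, ?_, fun u hu => ?_⟩
  · simpa using e.contDiff.comp_contDiffOn hPsymm
  · exact (hP ▸ hΦ.mono hPU : ContDiffOn ℝ n P P.source).comp e.symm.contDiff.contDiffOn
      fun y hy => by simpa using hy
  · rw [← hP0 u]
    exact ⟨by simpa using P.map_source hu, by simp [P.left_inv hu]⟩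

end Immersion

section Chart

variable {E : Type*} [NormedAddCommGroup E] [NormedSpace ℝ E] {H : Type*} [TopologicalSpace H]
  (I : ModelWithCorners ℝ E H) [I.Boundaryless]
  {M : Type*} [TopologicalSpace M] [ChartedSpace H M]

/-- The preferred chart at `x` followed by a change of coordinates `Θ` of the model vector space:
the way to turn a coordinate change found by calculus into a chart of the manifold. -/
noncomputable def chartAtTrans (x : M) (Θ : OpenPartialHomeomorph E E) :
    OpenPartialHomeomorph M H :=
  ((chartAt H x).trans I.toHomeomorph.toOpenPartialHomeomorph).trans
    (Θ.trans I.toHomeomorph.symm.toOpenPartialHomeomorph)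

variable (x : M) (Θ : OpenPartialHomeomorph E E)

theorem chartAtTrans_extend_apply (y : M) :
    (chartAtTrans I x Θ).extend I y = Θ (extChartAt I x y) :=
  I.toHomeomorph.apply_symm_apply _

theorem chartAtTrans_extend_symm_apply (v : E) :
    ((chartAtTrans I x Θ).extend I).symm v = (extChartAt I x).symm (Θ.symm v) :=
  congrArg (fun w => (extChartAt I x).symm (Θ.symm w)) (I.toHomeomorph.apply_symm_apply v)

theorem chartAtTrans_source :
    (chartAtTrans I x Θ).source = (extChartAt I x).source ∩ extChartAt I x ⁻¹' Θ.source := by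
  ext y
  simp [chartAtTrans, extChartAt]

theorem mem_chartAtTrans_extend_target {v : E} :
    v ∈ ((chartAtTrans I x Θ).extend I).target ↔
      v ∈ Θ.target ∧ Θ.symm v ∈ (extChartAt I x).target := by
  simp [chartAtTrans, extChartAt, I.range_eq_univ]

theorem chartAtTrans_mem_maximalAtlas {n : ℕ∞ω} [IsManifold I n M]
    (hΘ : ContDiffOn ℝ n Θ Θ.source) (hΘ' : ContDiffOn ℝ n Θ.symm Θ.target) :
    chartAtTrans I x Θ ∈ IsManifold.maximalAtlas I n M := by
  have hI : ContMDiff 𝓘(ℝ, E) I n I.symm := by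
    rw [← contMDiffOn_univ, ← I.range_eq_univ]
    exact I.contMDiffOn_symm
  refine (chartAtTrans I x Θ).mem_maximalAtlas_of_contMDiffOn ?_ ?_
  · rw [chartAtTrans_source]
    change ContMDiffOn I I n (I.symm ∘ Θ ∘ extChartAt I x) _
    exact hI.comp_contMDiffOn (hΘ.contMDiffOn.comp
      (contMDiffOn_extChartAt.mono fun y hy => by simpa using hy.1) fun y hy => hy.2)
  · have htarget : ∀ v ∈ (chartAtTrans I x Θ).target,
        I v ∈ Θ.target ∧ Θ.symm (I v) ∈ (extChartAt I x).target := fun v hv =>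
      (mem_chartAtTrans_extend_target I x Θ).1 (by simpa using hv)
    change ContMDiffOn I I n ((extChartAt I x).symm ∘ Θ.symm ∘ I) _
    exact (contMDiffOn_extChartAt_symm x).comp (hΘ'.contMDiffOn.comp I.contMDiff.contMDiffOn
      fun v hv => (htarget v hv).1) fun v hv => (htarget v hv).2

end Chart

section ImmersionCriterion

variable {E E' F : Type*} [NormedAddCommGroup E] [NormedSpace ℝ E] [FiniteDimensional ℝ E]
  [NormedAddCommGroup E'] [NormedSpace ℝ E'] [FiniteDimensional ℝ E']
  [NormedAddCommGroup F] [NormedSpace ℝ F] [FiniteDimensional ℝ F]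
  {H H' : Type*} [TopologicalSpace H] [TopologicalSpace H']
  {I : ModelWithCorners ℝ E H} {J : ModelWithCorners ℝ E' H'} [I.Boundaryless] [J.Boundaryless]
  {M N : Type*} [TopologicalSpace M] [ChartedSpace H M] [TopologicalSpace N] [ChartedSpace H' N]
  {n : ℕ∞ω} [IsManifold I n M] [IsManifold J n N] {f : M → N}

theorem isImmersionAtOfComplement_of_injective_mfderiv {x : M} (hn : n ≠ 0)
    (hf : ContMDiff I J n f) (hinj : Injective (mfderiv I J f x))
    (hF : Module.finrank ℝ E + Module.finrank ℝ F = Module.finrank ℝ E') :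
    Manifold.IsImmersionAtOfComplement F I J n f x := by
  let U := (extChartAt I x).target ∩ (extChartAt I x).symm ⁻¹' (f ⁻¹' (extChartAt J (f x)).source)
  have hU : IsOpen U := (continuousOn_extChartAt_symm x).isOpen_inter_preimage
    (isOpen_extChartAt_target x) ((isOpen_extChartAt_source (f x)).preimage hf.continuous)
  have hxU : extChartAt I x x ∈ U := ⟨mem_extChartAt_target x, by simp⟩
  have hwritten : ContDiffOn ℝ n (writtenInExtChartAt I J x f) U := (contMDiff_iff.1 hf).2 x (f x)
  rw [(hf.contMDiffAt.mdifferentiableAt hn).mfderiv, I.range_eq_univ, fderivWithin_univ] at hinj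
  obtain ⟨Θ, e, V, hV, hxV, hΘ, hΘ', hst⟩ := exists_straightening hU hxU hn hwritten hinj hF
  refine Manifold.IsImmersionAtOfComplement.mk_of_continuousAt hf.continuous.continuousAt e
    (chartAtTrans I x (.ofSet V hV)) (chartAtTrans J (f x) Θ) ?_ ?_
    (chartAtTrans_mem_maximalAtlas I x _ contDiff_id.contDiffOn contDiff_id.contDiffOn)
    (chartAtTrans_mem_maximalAtlas J (f x) Θ hΘ hΘ') fun u hu => ?_
  · rw [chartAtTrans_source]
    exact ⟨mem_extChartAt_source x, hxV⟩
  · rw [chartAtTrans_source]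
    refine ⟨mem_extChartAt_source (f x), ?_⟩
    simpa [writtenInExtChartAt, extChartAt_to_inv] using (hst _ hxV).1
  · simp only [comp_apply, chartAtTrans_extend_apply, chartAtTrans_extend_symm_apply]
    exact (hst u ((mem_chartAtTrans_extend_target I x _).1 hu).1).2

theorem isImmersion_of_injective_mfderiv (hn : n ≠ 0) (hf : ContMDiff I J n f)
    (hinj : ∀ x, Injective (mfderiv I J f x)) : Manifold.IsImmersion I J n f := by
  let F := EuclideanSpace ℝ (Fin (Module.finrank ℝ E' - Module.finrank ℝ E))
  have hcompl : Manifold.IsImmersionOfComplement F I J n f := fun x => by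
    have hle : Module.finrank ℝ E ≤ Module.finrank ℝ E' :=
      LinearMap.finrank_le_finrank_of_injective (f := (mfderiv I J f x : E →L[ℝ] E').toLinearMap)
        (hinj x)
    refine isImmersionAtOfComplement_of_injective_mfderiv hn hf (hinj x) ?_
    rw [finrank_euclideanSpace_fin]
    lia
  exact hcompl.isImmersion

end ImmersionCriterion

section Submanifold

variable {Z : Type*} [NormedAddCommGroup Z] [NormedSpace ℝ Z]
  {E : Type*} [NormedAddCommGroup E] [NormedSpace ℝ E] {H : Type*} [TopologicalSpace H]
  {I : ModelWithCorners ℝ E H} {N : Type*} [TopologicalSpace N] [ChartedSpace H N]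
  {n : ℕ∞ω} {S S' : Set N}

variable (I Z n S) in
/-- A chart of the subset `S` of a manifold, as a submanifold: the coordinates `coord` extend to a
`C^n` map on an open subset of the ambient manifold, and are inverse there to the `C^n`
parametrization `param` of `S`.  Both maps are total functions, meaningful only on `source` and
`target`. -/
structure SubmanifoldChart where
  coord : N → Z
  param : Z → N
  source : Set N
  target : Set Z
  isOpen_source : IsOpen source
  isOpen_target : IsOpen target
  contMDiffOn_coord : ContMDiffOn I 𝓘(ℝ, Z) n coord source
  contMDiffOn_param : ContMDiffOn 𝓘(ℝ, Z) I n param target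
  coord_mem_target : ∀ ⦃x⦄, x ∈ S → x ∈ source → coord x ∈ target
  param_mem : ∀ ⦃z⦄, z ∈ target → param z ∈ S
  param_mem_source : ∀ ⦃z⦄, z ∈ target → param z ∈ source
  param_coord : ∀ ⦃x⦄, x ∈ S → x ∈ source → param (coord x) = x
  coord_param : ∀ ⦃z⦄, z ∈ target → coord (param z) = z

namespace SubmanifoldChart

/-- The restriction of a submanifold chart to a relatively open subset. -/
def restrict (c : SubmanifoldChart Z I n S) (hS' : S' ⊆ S)
    (hopen : IsOpen ((↑) ⁻¹' S' : Set S)) : SubmanifoldChart Z I n S' where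
  coord := c.coord
  param := c.param
  source := c.source
  target := c.target ∩ c.param ⁻¹' S'
  isOpen_source := c.isOpen_source
  isOpen_target := by
    obtain ⟨O, hO, hOS'⟩ := isOpen_induced_iff.1 hopen
    convert c.contMDiffOn_param.continuousOn.isOpen_inter_preimage c.isOpen_target hO using 1
    ext z
    exact and_congr_right fun hz => (Set.ext_iff.1 hOS' ⟨c.param z, c.param_mem hz⟩).symm
  contMDiffOn_coord := c.contMDiffOn_coord
  contMDiffOn_param := c.contMDiffOn_param.mono inter_subset_left
  coord_mem_target x hx hxc := ⟨c.coord_mem_target (hS' hx) hxc, by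
    rwa [mem_preimage, c.param_coord (hS' hx) hxc]⟩
  param_mem _ hz := hz.2
  param_mem_source _ hz := c.param_mem_source hz.1
  param_coord _ hx := c.param_coord (hS' hx)
  coord_param _ hz := c.coord_param hz.1

open Classical in
/-- A submanifold chart as a chart of the subtype; `x₀` is the junk value of the inverse outside
`c.target`. -/
noncomputable def toChart (c : SubmanifoldChart Z I n S) (x₀ : S) : OpenPartialHomeomorph S Z where
  toFun x := c.coord x
  invFun z := if hz : c.param z ∈ S then ⟨c.param z, hz⟩ else x₀
  source := {x | (x : N) ∈ c.source}
  target := c.target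
  map_source' x hx := c.coord_mem_target x.2 hx
  map_target' z hz := by
    rw [dif_pos (c.param_mem hz)]
    exact c.param_mem_source hz
  left_inv' x hx := by
    have hx' := c.param_coord x.2 hx
    rw [dif_pos (by rw [hx']; exact x.2)]
    exact Subtype.ext hx'
  right_inv' z hz := by
    rw [dif_pos (c.param_mem hz)]
    exact c.coord_param hz
  open_source := c.isOpen_source.preimage continuous_subtype_val
  open_target := c.isOpen_target
  continuousOn_toFun := c.contMDiffOn_coord.continuousOn.comp
    continuous_subtype_val.continuousOn fun _ hx => hx
  continuousOn_invFun := by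
    rw [IsInducing.subtypeVal.continuousOn_iff]
    refine c.contMDiffOn_param.continuousOn.congr fun z hz => ?_
    rw [comp_apply, dif_pos (c.param_mem hz)]

theorem coe_toChart_symm (c : SubmanifoldChart Z I n S) (x₀ : S) {z : Z} (hz : z ∈ c.target) :
    ((c.toChart x₀).symm z : N) = c.param z :=
  congrArg Subtype.val (dif_pos (c.param_mem hz))

/-- The differentiable structure on `S` given by submanifold charts around its points. -/
noncomputable abbrev chartedSpace (c : S → SubmanifoldChart Z I n S)
    (hc : ∀ x : S, (x : N) ∈ (c x).source) : ChartedSpace Z S where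
  atlas := range fun x => (c x).toChart x
  chartAt x := (c x).toChart x
  mem_chart_source := hc
  chart_mem_atlas := mem_range_self

variable (c : S → SubmanifoldChart Z I n S) (hc : ∀ x : S, (x : N) ∈ (c x).source)

theorem isManifold :
    letI := chartedSpace c hc
    IsManifold 𝓘(ℝ, Z) n S := by
  let := chartedSpace c hc
  refine isManifold_of_contDiffOn 𝓘(ℝ, Z) n S ?_
  rintro _ _ ⟨x, rfl⟩ ⟨y, rfl⟩
  have hsource : (((c x).toChart x).symm ≫ₕ (c y).toChart y).source ⊆
      (c x).target ∩ (c x).param ⁻¹' (c y).source := fun z hz => by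
    obtain ⟨hzx, hzy⟩ : z ∈ (c x).target ∧ (((c x).toChart x).symm z : N) ∈ (c y).source := by
      rwa [OpenPartialHomeomorph.trans_source] at hz
    exact ⟨hzx, by rwa [coe_toChart_symm _ _ hzx] at hzy⟩
  have hsmooth : ContDiffOn ℝ n ((c y).coord ∘ (c x).param)
      ((c x).target ∩ (c x).param ⁻¹' (c y).source) :=
    ((c y).contMDiffOn_coord.comp ((c x).contMDiffOn_param.mono inter_subset_left)
      fun _ hz => hz.2).contDiffOn
  have htransition : ContDiffOn ℝ n (((c x).toChart x).symm ≫ₕ (c y).toChart y)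
      (((c x).toChart x).symm ≫ₕ (c y).toChart y).source :=
    (hsmooth.mono hsource).congr fun z hz =>
      congrArg (c y).coord (coe_toChart_symm (c x) x (hsource hz).1)
  simpa using htransition

theorem contMDiff_val :
    letI := chartedSpace c hc
    ContMDiff 𝓘(ℝ, Z) I n ((↑) : S → N) := by
  let := chartedSpace c hc
  have := isManifold c hc
  intro x
  have hparam : ContMDiffAt 𝓘(ℝ, Z) I n (c x).param ((c x).coord x) :=
    (c x).contMDiffOn_param.contMDiffAt
      ((c x).isOpen_target.mem_nhds ((c x).coord_mem_target x.2 (hc x)))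
  refine (hparam.comp x (contMDiffAt_of_mem_maximalAtlas
    (IsManifold.chart_mem_maximalAtlas x) (hc x))).congr_of_eventuallyEq ?_
  filter_upwards [(chartAt Z x).open_source.mem_nhds (hc x)] with y hy
  exact ((c x).param_coord y.2 hy).symm

theorem injective_mfderiv_val (hn : n ≠ 0) (x : S) :
    letI := chartedSpace c hc
    Injective (mfderiv 𝓘(ℝ, Z) I ((↑) : S → N) x) := by
  let := chartedSpace c hc
  have := isManifold c hc
  have : IsManifold 𝓘(ℝ, Z) 1 S := .of_le (ENat.one_le_iff_ne_zero_withTop.2 hn)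
  have hcoord : MDifferentiableAt I 𝓘(ℝ, Z) (c x).coord x :=
    ((c x).contMDiffOn_coord.contMDiffAt ((c x).isOpen_source.mem_nhds (hc x))).mdifferentiableAt hn
  have hchart := injective_mfderiv_extend (I := 𝓘(ℝ, Z))
    (IsManifold.chart_mem_maximalAtlas x) (mem_chart_source Z x)
  have hcomp := mfderiv_comp x hcoord ((contMDiff_val c hc x).mdifferentiableAt hn)
  refine Injective.of_comp (f := mfderiv I 𝓘(ℝ, Z) (c x).coord x) ?_
  rw [← ContinuousLinearMap.coe_comp, ← hcomp]
  exact hchart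

theorem isSmoothEmbedding_val [FiniteDimensional ℝ Z] [FiniteDimensional ℝ E] [I.Boundaryless]
    [IsManifold I n N] (hn : n ≠ 0) :
    letI := chartedSpace c hc
    Manifold.IsSmoothEmbedding 𝓘(ℝ, Z) I n ((↑) : S → N) := by
  let := chartedSpace c hc
  have := isManifold c hc
  exact ⟨isImmersion_of_injective_mfderiv hn (contMDiff_val c hc)
    (injective_mfderiv_val c hc hn), IsEmbedding.subtypeVal⟩

end SubmanifoldChart

end Submanifold

section NormalFrame

variable {K F W : Type*} [NormedAddCommGroup K] [NormedSpace ℝ K] [NormedAddCommGroup F]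
  [NormedSpace ℝ F] [NormedAddCommGroup W] [InnerProductSpace ℝ W]

/-- The linear map `(t, a) ↦ t v + L a`.  For `v = G u` and `L = dG_u` it is the differential at
`(1, u)` of the cone `(t, x) ↦ t G x` over `G`, whose normals are the normals of `G` in the
sphere. -/
noncomputable def coneMap (v : W) (L : K →L[ℝ] W) : ℝ × K →L[ℝ] W :=
  (ContinuousLinearMap.toSpanSingleton ℝ v).coprod L

@[simp]
theorem coneMap_apply (v : W) (L : K →L[ℝ] W) (a : ℝ × K) : coneMap v L a = a.1 • v + L a.2 := by
  simp [coneMap]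

theorem contDiff_coneMap [FiniteDimensional ℝ K] {n : ℕ∞ω} :
    ContDiff ℝ n fun x : W × (K →L[ℝ] W) => coneMap x.1 x.2 := by
  refine contDiff_clm_apply_iff.2 fun a => ?_
  simp only [coneMap_apply]
  exact (contDiff_const.smul contDiff_fst).add (contDiff_snd.clm_apply contDiff_const)

theorem mem_orthogonal_range_iff {L : K →L[ℝ] W} {w : W} :
    w ∈ L.rangeᗮ ↔ ∀ a, ⟪w, L a⟫_ℝ = 0 := by
  simp [Submodule.mem_orthogonal']

theorem mem_orthogonal_range_coneMap_iff {v : W} {L : K →L[ℝ] W} {w : W} :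
    w ∈ (coneMap v L).rangeᗮ ↔ ⟪w, v⟫_ℝ = 0 ∧ ∀ a, ⟪w, L a⟫_ℝ = 0 := by
  rw [mem_orthogonal_range_iff]
  refine ⟨fun h => ⟨by simpa using h (1, 0), fun a => by simpa using h (0, a)⟩, fun h a => ?_⟩
  rw [coneMap_apply, inner_add_right, inner_smul_right, h.1, h.2, mul_zero, add_zero]

theorem injective_coneMap {v : W} {L : K →L[ℝ] W} (hL : Injective L) (hv : v ≠ 0)
    (horth : v ∈ L.rangeᗮ) : Injective (coneMap v L) := by
  rw [injective_iff_map_eq_zero]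
  rintro ⟨t, a⟩ h
  rw [coneMap_apply] at h
  have ht : t = 0 := by
    have hinner := congrArg (fun w => ⟪v, w⟫_ℝ) h
    simpa [inner_add_right, inner_smul_right, mem_orthogonal_range_iff.1 horth a, hv] using hinner
  subst ht
  simpa using (injective_iff_map_eq_zero L).1 hL a (by simpa using h)

theorem finrank_add_finrank_orthogonal_range [FiniteDimensional ℝ W] {L : K →L[ℝ] W}
    (hL : Injective L) :
    Module.finrank ℝ K + Module.finrank ℝ L.rangeᗮ = Module.finrank ℝ W := by
  rw [← L.range.finrank_add_finrank_orthogonal, LinearMap.finrank_range_of_inj hL]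

/-- The coordinates `w ↦ (⟪w, L ·⟫, ⟪V₀, w⟫, T w)` on `W`.  When they are linear coordinates, the
second and third one are coordinates on the normal space `(range L)ᗮ`, for all `L` at once. -/
noncomputable def frameMap (V₀ : W) (T : W →L[ℝ] F) (L : K →L[ℝ] W) :
    W →L[ℝ] (K →L[ℝ] ℝ) × ℝ × F :=
  (((ContinuousLinearMap.compL ℝ K W ℝ).flip L).comp (innerSL ℝ)).prod ((innerSL ℝ V₀).prod T)

theorem frameMap_apply (V₀ : W) (T : W →L[ℝ] F) (L : K →L[ℝ] W) (w : W) :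
    frameMap V₀ T L w = ((innerSL ℝ w).comp L, ⟪V₀, w⟫_ℝ, T w) := rfl

theorem frameMap_apply_of_mem_orthogonal {V₀ : W} {T : W →L[ℝ] F} {L : K →L[ℝ] W} {w : W}
    (hw : w ∈ L.rangeᗮ) : frameMap V₀ T L w = (0, ⟪V₀, w⟫_ℝ, T w) := by
  rw [frameMap_apply]
  congr 1
  ext a
  exact mem_orthogonal_range_iff.1 hw a

theorem contDiff_frameMap [FiniteDimensional ℝ W] (V₀ : W) (T : W →L[ℝ] F) {n : ℕ∞ω} :
    ContDiff ℝ n fun L : K →L[ℝ] W => frameMap V₀ T L := by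
  refine contDiff_clm_apply_iff.2 fun w => ?_
  simp only [frameMap_apply]
  fun_prop

theorem exists_isInvertible_frameMap [FiniteDimensional ℝ K] [FiniteDimensional ℝ F]
    [FiniteDimensional ℝ W] {L : K →L[ℝ] W} (hL : Injective L) {V₀ : W} (hV₀ : V₀ ≠ 0)
    (horth : V₀ ∈ L.rangeᗮ)
    (hfinrank : Module.finrank ℝ W = Module.finrank ℝ K + 1 + Module.finrank ℝ F) :
    ∃ T : W →L[ℝ] F, (frameMap V₀ T L).IsInvertible := by
  let C : Submodule ℝ W := (coneMap V₀ L).rangeᗮ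
  have hC : Module.finrank ℝ C = Module.finrank ℝ F := by
    have hsum : Module.finrank ℝ (ℝ × K) + Module.finrank ℝ C = Module.finrank ℝ W :=
      finrank_add_finrank_orthogonal_range (injective_coneMap hL hV₀ horth)
    rw [Module.finrank_prod, Module.finrank_self] at hsum
    omega
  let e : C ≃L[ℝ] F := ContinuousLinearEquiv.ofFinrankEq hC
  let T : W →L[ℝ] F := (e : C →L[ℝ] F).comp C.orthogonalProjectionOnto
  have hinj : Injective (frameMap V₀ T L) := by
    rw [injective_iff_map_eq_zero]
    intro w hw
    simp only [frameMap_apply, Prod.mk_eq_zero] at hw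
    have hwC : w ∈ C := mem_orthogonal_range_coneMap_iff.2
      ⟨by rw [real_inner_comm]; exact hw.2.1, fun a => DFunLike.congr_fun hw.1 a⟩
    have hproj : C.orthogonalProjectionOnto w = 0 := by simpa [T] using hw.2.2
    have hwC' := C.orthogonalProjectionOnto_mem_subspace_eq_self ⟨w, hwC⟩
    rwa [hproj, eq_comm, Submodule.mk_eq_zero] at hwC'
  have hdim : Module.finrank ℝ W = Module.finrank ℝ ((K →L[ℝ] ℝ) × ℝ × F) := by
    rw [Module.finrank_prod, Module.finrank_prod, Module.finrank_self, hfinrank,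
      LinearMap.toContinuousLinearMap.symm.finrank_eq, Module.finrank_linearMap_self]
    ring
  exact ⟨T, (LinearEquiv.ofInjectiveOfFinrankEq (frameMap V₀ T L).toLinearMap hinj
    hdim).toContinuousLinearEquiv, rfl⟩

variable {V₀ : W} {T : W →L[ℝ] F} {L : K →L[ℝ] W}

/-- The vector normal to `range L` with coordinates `⟪V₀, w⟫ = 1` and `T w = y`. -/
noncomputable def affineNormal (V₀ : W) (T : W →L[ℝ] F) (L : K →L[ℝ] W) (y : F) : W :=
  (frameMap V₀ T L).inverse (0, 1, y)

/-- The unit vector normal to `range L` in the direction of `affineNormal V₀ T L y`: the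
parametrization of an open half of the unit sphere of `(range L)ᗮ` by `y`. -/
noncomputable def unitNormal (V₀ : W) (T : W →L[ℝ] F) (L : K →L[ℝ] W) (y : F) : W :=
  ‖affineNormal V₀ T L y‖⁻¹ • affineNormal V₀ T L y

theorem frameMap_affineNormal (h : (frameMap V₀ T L).IsInvertible) (y : F) :
    frameMap V₀ T L (affineNormal V₀ T L y) = (0, 1, y) :=
  h.self_apply_inverse _

theorem affineNormal_eq_of_frameMap_eq (h : (frameMap V₀ T L).IsInvertible) {w : W} {y : F}
    (hw : frameMap V₀ T L w = (0, 1, y)) : affineNormal V₀ T L y = w := by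
  rw [affineNormal, ← hw]
  exact h.inverse_apply_self w

theorem affineNormal_ne_zero (h : (frameMap V₀ T L).IsInvertible) (y : F) :
    affineNormal V₀ T L y ≠ 0 := fun h0 => by
  have hone : (0 : ℝ) = 1 := by
    simpa [h0] using congrArg (fun c => c.2.1) (frameMap_affineNormal h y)
  exact zero_ne_one hone

theorem norm_unitNormal (h : (frameMap V₀ T L).IsInvertible) (y : F) :
    ‖unitNormal V₀ T L y‖ = 1 :=
  norm_smul_inv_norm (𝕜 := ℝ) (affineNormal_ne_zero h y)

theorem unitNormal_mem_orthogonal (h : (frameMap V₀ T L).IsInvertible) (y : F) :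
    unitNormal V₀ T L y ∈ L.rangeᗮ := by
  refine Submodule.smul_mem _ _ (mem_orthogonal_range_iff.2 fun a => ?_)
  exact DFunLike.congr_fun (congrArg Prod.fst (frameMap_affineNormal h y)) a

theorem inner_unitNormal (h : (frameMap V₀ T L).IsInvertible) (y : F) :
    ⟪V₀, unitNormal V₀ T L y⟫_ℝ = ‖affineNormal V₀ T L y‖⁻¹ := by
  have hinner : ⟪V₀, affineNormal V₀ T L y⟫_ℝ = 1 :=
    congrArg (fun c => c.2.1) (frameMap_affineNormal h y)
  rw [unitNormal, inner_smul_right, hinner, mul_one]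

theorem inner_unitNormal_pos (h : (frameMap V₀ T L).IsInvertible) (y : F) :
    0 < ⟪V₀, unitNormal V₀ T L y⟫_ℝ := by
  rw [inner_unitNormal h, inv_pos, norm_pos_iff]
  exact affineNormal_ne_zero h y

/-- The coordinate on unit vectors `V` with `0 < ⟪V₀, V⟫` inverse to `unitNormal`. -/
noncomputable def normalCoord (V₀ : W) (T : W →L[ℝ] F) (V : W) : F :=
  (⟪V₀, V⟫_ℝ)⁻¹ • T V

theorem normalCoord_unitNormal (h : (frameMap V₀ T L).IsInvertible) (y : F) :
    normalCoord V₀ T (unitNormal V₀ T L y) = y := by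
  have hT : T (affineNormal V₀ T L y) = y :=
    congrArg (fun c => c.2.2) (frameMap_affineNormal h y)
  rw [normalCoord, inner_unitNormal h, unitNormal, map_smul, hT, inv_inv,
    smul_inv_smul₀ (norm_ne_zero_iff.2 (affineNormal_ne_zero h y))]

theorem unitNormal_normalCoord (h : (frameMap V₀ T L).IsInvertible) {V : W} (hV : ‖V‖ = 1)
    (hVL : V ∈ L.rangeᗮ) (hpos : 0 < ⟪V₀, V⟫_ℝ) :
    unitNormal V₀ T L (normalCoord V₀ T V) = V := by
  have haffine : affineNormal V₀ T L (normalCoord V₀ T V) = (⟪V₀, V⟫_ℝ)⁻¹ • V := by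
    refine affineNormal_eq_of_frameMap_eq h ?_
    rw [frameMap_apply_of_mem_orthogonal (Submodule.smul_mem _ _ hVL), inner_smul_right, map_smul,
      inv_mul_cancel₀ hpos.ne', normalCoord]
  rw [unitNormal, haffine, norm_smul, hV, mul_one, Real.norm_of_nonneg (inv_nonneg.2 hpos.le),
    inv_inv, smul_inv_smul₀ hpos.ne']

theorem contDiffAt_unitNormal [FiniteDimensional ℝ W] {n : ℕ∞ω} {y : F}
    (h : (frameMap V₀ T L).IsInvertible) :
    ContDiffAt ℝ n (fun z : (K →L[ℝ] W) × F => unitNormal V₀ T z.1 z.2) (L, y) := by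
  have := FiniteDimensional.complete ℝ W
  obtain ⟨e, he⟩ := h
  have hinverse : ContDiffAt ℝ n (fun z : (K →L[ℝ] W) × F => (frameMap V₀ T z.1).inverse) (L, y) :=
    (he ▸ contDiffAt_map_inverse e).comp (L, y)
      ((contDiff_frameMap V₀ T).comp contDiff_fst).contDiffAt
  have haffine : ContDiffAt ℝ n (fun z : (K →L[ℝ] W) × F => affineNormal V₀ T z.1 z.2) (L, y) :=
    hinverse.clm_apply (by fun_prop)
  have hne := affineNormal_ne_zero ⟨e, he⟩ y
  exact ((haffine.norm ℝ hne).inv (norm_ne_zero_iff.2 hne)).smul haffine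

end NormalFrame

section Matrix

open Matrix

theorem esymm_eq_zero_of_card_filter_ne_zero_lt {R : Type*} [CommSemiring R] [DecidableEq R]
    {s : Multiset R} {r : ℕ} (h : (s.filter (· ≠ 0)).card < r) : s.esymm r = 0 := by
  refine Multiset.sum_eq_zero fun x hx => ?_
  obtain ⟨t, ht, rfl⟩ := Multiset.mem_map.1 hx
  obtain ⟨hts, rfl⟩ := Multiset.mem_powersetCard.1 ht
  refine Multiset.prod_eq_zero (by_contra fun h0 => h.not_ge (Multiset.card_le_card ?_))
  exact Multiset.le_filter.2 ⟨hts, fun a ha ha0 => h0 (ha0 ▸ ha)⟩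

theorem filter_roots_X_pow_mul {R : Type*} [CommRing R] [IsDomain R] [DecidableEq R]
    {p : Polynomial R} (hp : p.Monic) (k : ℕ) :
    (Polynomial.X ^ k * p).roots.filter (· ≠ 0) = p.roots.filter (· ≠ 0) := by
  have hzero : (k • ({0} : Multiset R)).filter (· ≠ 0) = 0 :=
    Multiset.filter_eq_nil.2 fun a ha => by simpa using Multiset.mem_of_mem_nsmul ha
  rw [Polynomial.roots_mul (mul_ne_zero (pow_ne_zero _ Polynomial.X_ne_zero) hp.ne_zero),
    Polynomial.roots_X_pow, Multiset.filter_add, hzero, zero_add]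

theorem esymm_roots_charpoly_mul_eq_zero {R n m : Type*} [CommRing R] [IsDomain R] [Fintype n]
    [DecidableEq n] [Fintype m] (A : Matrix n m R) (B : Matrix m n R) {r : ℕ}
    (hr : Fintype.card m < r) : (A * B).charpoly.roots.esymm r = 0 := by
  classical
  refine esymm_eq_zero_of_card_filter_ne_zero_lt (lt_of_le_of_lt ?_ hr)
  rw [← filter_roots_X_pow_mul (charpoly_monic _) (Fintype.card m), charpoly_mul_comm',
    filter_roots_X_pow_mul (charpoly_monic _)]
  calc ((B * A).charpoly.roots.filter (· ≠ 0)).card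
      ≤ (B * A).charpoly.roots.card := Multiset.card_le_card (Multiset.filter_le _ _)
    _ ≤ (B * A).charpoly.natDegree := Polynomial.card_roots' _
    _ = Fintype.card m := charpoly_natDegree_eq_dim _

theorem trace_inv_eq_zero_of_trace_eq_zero {R : Type*} [CommRing R] {A : Matrix (Fin 2) (Fin 2) R}
    (h : A.trace = 0) : A⁻¹.trace = 0 := by
  rw [trace_fin_two] at h
  rw [inv_def, trace_smul, adjugate_fin_two, trace_fin_two_of, add_comm, h, smul_zero]

theorem mul_self_eq_zero_of_trace_of_det {R : Type*} [CommRing R] {A : Matrix (Fin 2) (Fin 2) R}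
    (htr : A.trace = 0) (hdet : A.det = 0) : A * A = 0 := by
  nontriviality R
  have hCH := A.aeval_self_charpoly
  rw [charpoly_fin_two, htr, hdet] at hCH
  simpa [pow_two] using hCH

theorem eq_zero_of_conjTranspose_mul_mul_eq_zero {R n m : Type*} [CommRing R] [PartialOrder R]
    [StarRing R] [Fintype n] [Finite m] {A : Matrix n n R} (hA : A.PosDef) {B : Matrix n m R}
    (h : Bᴴ * A * B = 0) : B = 0 := by
  classical
  have := Fintype.ofFinite m
  refine Matrix.ext_of_mulVec_single fun i => ?_
  rw [zero_mulVec]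
  by_contra hne
  have hpos := hA.dotProduct_mulVec_pos hne
  rw [star_mulVec, dotProduct_mulVec, vecMul_vecMul, ← dotProduct_mulVec, mulVec_mulVec, h] at hpos
  simp at hpos

theorem det_ne_zero_of_trace_inv_mul_eq_zero {A B : Matrix (Fin 2) (Fin 2) ℝ} (hA : A.PosDef)
    (hB : B.IsHermitian) (hne : B ≠ 0) (htr : (A⁻¹ * B).trace = 0) : B.det ≠ 0 := by
  intro hdet
  have hAunit : IsUnit A.det := hA.det_pos.ne'.isUnit
  have hsq : (A⁻¹ * B) * (A⁻¹ * B) = 0 :=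
    mul_self_eq_zero_of_trace_of_det htr (by rw [det_mul, hdet, mul_zero])
  have hconj : B * A⁻¹ * B = 0 := by
    have h := congrArg (A * ·) hsq
    simpa only [Matrix.mul_assoc, mul_nonsing_inv_cancel_left _ _ hAunit, mul_zero] using h
  exact hne (eq_zero_of_conjTranspose_mul_mul_eq_zero hA.inv (hB.eq.symm ▸ hconj))

theorem trace_inv_mul_eq_trace_inv_mul {R ι κ : Type*} [CommRing R] [Fintype ι] [DecidableEq ι]
    [Fintype κ] [DecidableEq κ] {J : Matrix κ κ R} {I H : Matrix ι ι R} {F : Matrix ι κ R}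
    {P : Matrix κ ι R} (hJ : IsUnit J.det) (hH : IsUnit H.det) (hJP : J * P = -(Fᵀ * H))
    (hI : I = -((F * P)ᵀ * H)) : (J⁻¹ * (Fᵀ * H * F)).trace = (H⁻¹ * I).trace := by
  have hleft : J⁻¹ * (Fᵀ * H * F) = -(P * F) := by
    rw [← neg_neg (Fᵀ * H), ← hJP, Matrix.neg_mul, Matrix.mul_neg, Matrix.mul_assoc,
      nonsing_inv_mul_cancel_left _ _ hJ]
  have hright : I * H⁻¹ = -(F * P)ᵀ := by
    rw [hI, Matrix.neg_mul, mul_nonsing_inv_cancel_right _ _ hH]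
  rw [hleft, trace_mul_comm H⁻¹, hright, trace_neg, trace_neg, trace_transpose,
    trace_mul_comm]

end Matrix

section PolarTrace

open Matrix LinearMap

variable {E Z W ι κ : Type*} [AddCommGroup E] [Module ℝ E] [AddCommGroup Z] [Module ℝ Z]
  [NormedAddCommGroup W] [InnerProductSpace ℝ W] [Fintype ι] [DecidableEq ι] [Fintype κ]
  [DecidableEq κ]

/-- The first fundamental form `⟪D ·, D ·⟫` of a map with differential `D`. -/
noncomputable def firstForm (D : E →ₗ[ℝ] W) : LinearMap.BilinForm ℝ E :=
  (innerₗ W).compl₁₂ D D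

theorem firstForm_apply (D : E →ₗ[ℝ] W) (x y : E) : firstForm D x y = ⟪D x, D y⟫_ℝ := rfl

theorem posDef_toMatrix₂_firstForm (b : Module.Basis ι ℝ E) {D : E →ₗ[ℝ] W} (hD : Injective D) :
    (toMatrix₂ b b (firstForm D)).PosDef := by
  have hgram : toMatrix₂ b b (firstForm D) = gram ℝ (D ∘ b) := by
    ext i j
    rw [toMatrix₂_apply, firstForm_apply, gram_apply]
    rfl
  rw [hgram]
  exact posDef_gram_of_linearIndependent (b.linearIndependent.map' D (ker_eq_bot.2 hD))

theorem trace_inv_firstForm_mul_polar (b : Module.Basis ι ℝ E) (c : Module.Basis κ ℝ Z)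
    {DG : E →ₗ[ℝ] W} {DV : Z →ₗ[ℝ] W} {π : Z →ₗ[ℝ] E} {H : LinearMap.BilinForm ℝ E}
    (hpair : ∀ x a, ⟪DV x, DG a⟫_ℝ = -H (π x) a) (hDV : Injective DV)
    (hrange : DG.range ≤ DV.range) (hH : (toMatrix₂ b b H).det ≠ 0) :
    ((toMatrix₂ c c (firstForm DV))⁻¹ * toMatrix₂ c c (H.compl₁₂ π π)).trace =
      ((toMatrix₂ b b H)⁻¹ * toMatrix₂ b b (firstForm DG)).trace := by
  obtain ⟨leftInv, hleft⟩ := DV.exists_leftInverse_of_injective (ker_eq_bot.2 hDV)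
  let P : E →ₗ[ℝ] Z := leftInv ∘ₗ DG
  have hP (a : E) : DV (P a) = DG a := by
    obtain ⟨x, hx⟩ := hrange (mem_range_self DG a)
    simpa [P, ← hx] using congrArg DV (LinearMap.congr_fun hleft x)
  have hJ : IsUnit (toMatrix₂ c c (firstForm DV)).det :=
    (posDef_toMatrix₂_firstForm c hDV).det_pos.ne'.isUnit
  rw [toMatrix₂_compl₁₂ b b]
  refine trace_inv_mul_eq_trace_inv_mul (P := toMatrix b c P) hJ hH.isUnit ?_ ?_
  · rw [← toMatrix₂_compl₂, ← toMatrix₂_comp, ← map_neg]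
    congr 1
    ext x a
    simpa [firstForm_apply, hP] using hpair x a
  · rw [← toMatrix_comp, ← toMatrix₂_comp, ← map_neg]
    congr 1
    ext a a'
    simpa [firstForm_apply, hP] using hpair (P a) a'

end PolarTrace

section PolarPair

variable {E Z W : Type*} [NormedAddCommGroup E] [NormedSpace ℝ E] [NormedAddCommGroup Z]
  [NormedSpace ℝ Z] [NormedAddCommGroup W] [InnerProductSpace ℝ W]

theorem inner_fderiv_add_inner_fderiv_eq_zero {f h : E → W} {f' h' : E →L[ℝ] W} {z : E}
    (hf : HasFDerivAt f f' z) (hh : HasFDerivAt h h' z) {c : ℝ}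
    (hc : ∀ᶠ w in 𝓝 z, ⟪f w, h w⟫_ℝ = c) (x : E) : ⟪f z, h' x⟫_ℝ + ⟪f' x, h z⟫_ℝ = 0 := by
  have hconst : HasFDerivAt (fun w => ⟪f w, h w⟫_ℝ) (0 : E →L[ℝ] ℝ) z :=
    (hasFDerivAt_const c z).congr_of_eventuallyEq hc
  simpa using DFunLike.congr_fun ((hf.inner ℝ hh).unique hconst) x

theorem inner_fderiv_eq_zero_of_norm_eq {f : E → W} {z : E} (hf : DifferentiableAt ℝ f z) {r : ℝ}
    (hr : ∀ᶠ w in 𝓝 z, ‖f w‖ = r) (x : E) : ⟪f z, fderiv ℝ f z x⟫_ℝ = 0 := by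
  have hsum := inner_fderiv_add_inner_fderiv_eq_zero hf.hasFDerivAt hf.hasFDerivAt
    (hr.mono fun w hw => by rw [real_inner_self_eq_norm_sq, hw]) x
  rw [real_inner_comm (f z)] at hsum
  linarith

/-- The second fundamental form `⟪ν, d²G_u(a, b)⟫` of the immersion `G` at `u` in the normal
direction `ν`. -/
noncomputable def secondForm (G : E → W) (u : E) (ν : W) : LinearMap.BilinForm ℝ E :=
  LinearMap.mk₂ ℝ (fun a b => ⟪ν, fderiv ℝ (fderiv ℝ G) u a b⟫_ℝ)
    (by simp [inner_add_right]) (by simp [inner_smul_right]) (by simp [inner_add_right])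
    (by simp [inner_smul_right])

theorem secondForm_apply (G : E → W) (u : E) (ν : W) (a b : E) :
    secondForm G u ν a b = ⟪ν, fderiv ℝ (fderiv ℝ G) u a b⟫_ℝ := rfl

theorem isSymm_secondForm {G : E → W} {u : E} (hG : ContDiffAt ℝ 2 G u) (ν : W) :
    (secondForm G u ν).IsSymm :=
  ⟨fun a b => by
    rw [secondForm_apply, secondForm_apply, (hG.isSymmSndFDerivAt (by simp)).eq]⟩

/-- A map `G` into the unit sphere together with a family `V` of unit normals of `G` in the sphere
(`V w` is normal at `π w`), with parameters transverse to the fibres of `π` moving `V`. -/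
structure IsPolarPair (π : Z →L[ℝ] E) (G : E → W) (V : Z → W) (z : Z) : Prop where
  contDiffAt_base : ContDiffAt ℝ 2 G (π z)
  contDiffAt_normal : ContDiffAt ℝ 2 V z
  norm_base : ∀ᶠ u in 𝓝 (π z), ‖G u‖ = 1
  norm_normal : ∀ᶠ w in 𝓝 z, ‖V w‖ = 1
  normal_mem : ∀ᶠ w in 𝓝 z, V w ∈ (coneMap (G (π w)) (fderiv ℝ G (π w))).rangeᗮ
  vertical_eq_zero : ∀ x, π x = 0 → fderiv ℝ V z x = 0 → x = 0

namespace IsPolarPair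

variable {π : Z →L[ℝ] E} {G : E → W} {V : Z → W} {z : Z}

theorem differentiableAt_base (h : IsPolarPair π G V z) : DifferentiableAt ℝ G (π z) :=
  h.contDiffAt_base.differentiableAt (by simp)

theorem differentiableAt_normal (h : IsPolarPair π G V z) : DifferentiableAt ℝ V z :=
  h.contDiffAt_normal.differentiableAt (by simp)

theorem differentiableAt_fderiv_base (h : IsPolarPair π G V z) :
    DifferentiableAt ℝ (fderiv ℝ G) (π z) :=
  (h.contDiffAt_base.fderiv_right (m := 1) (by norm_num)).differentiableAt (by simp)

theorem differentiableAt_fderiv_normal (h : IsPolarPair π G V z) :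
    DifferentiableAt ℝ (fderiv ℝ V) z :=
  (h.contDiffAt_normal.fderiv_right (m := 1) (by norm_num)).differentiableAt (by simp)

theorem congr_normal (h : IsPolarPair π G V z) {V' : Z → W} (hV : V' =ᶠ[𝓝 z] V) :
    IsPolarPair π G V' z where
  contDiffAt_base := h.contDiffAt_base
  contDiffAt_normal := h.contDiffAt_normal.congr_of_eventuallyEq hV
  norm_base := h.norm_base
  norm_normal := by filter_upwards [hV, h.norm_normal] with w hw hnorm using hw ▸ hnorm
  normal_mem := by filter_upwards [hV, h.normal_mem] with w hw hmem using hw ▸ hmem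
  vertical_eq_zero := by simpa only [hV.fderiv_eq] using h.vertical_eq_zero

theorem normal_ne_zero (h : IsPolarPair π G V z) : V z ≠ 0 :=
  norm_ne_zero_iff.1 (h.norm_normal.self_of_nhds ▸ one_ne_zero)

theorem base_ne_zero (h : IsPolarPair π G V z) : G (π z) ≠ 0 :=
  norm_ne_zero_iff.1 (h.norm_base.self_of_nhds ▸ one_ne_zero)

theorem inner_normal_base (h : IsPolarPair π G V z) : ⟪V z, G (π z)⟫_ℝ = 0 :=
  (mem_orthogonal_range_coneMap_iff.1 h.normal_mem.self_of_nhds).1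

theorem inner_normal_fderiv_base (h : IsPolarPair π G V z) (a : E) :
    ⟪V z, fderiv ℝ G (π z) a⟫_ℝ = 0 :=
  (mem_orthogonal_range_coneMap_iff.1 h.normal_mem.self_of_nhds).2 a

theorem inner_normal_fderiv_normal (h : IsPolarPair π G V z) (x : Z) :
    ⟪V z, fderiv ℝ V z x⟫_ℝ = 0 :=
  inner_fderiv_eq_zero_of_norm_eq h.differentiableAt_normal h.norm_normal x

theorem inner_base_fderiv_base (h : IsPolarPair π G V z) (a : E) :
    ⟪G (π z), fderiv ℝ G (π z) a⟫_ℝ = 0 :=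
  inner_fderiv_eq_zero_of_norm_eq h.differentiableAt_base h.norm_base a

theorem eventually_inner_fderiv_normal_base (h : IsPolarPair π G V z) :
    ∀ᶠ w in 𝓝 z, ∀ x, ⟪fderiv ℝ V w x, G (π w)⟫_ℝ = 0 := by
  filter_upwards [h.contDiffAt_normal.eventually (by simp),
    π.continuous.continuousAt.eventually (h.contDiffAt_base.eventually (by simp)),
    h.normal_mem.eventually_nhds] with w hV hG hmem x
  have hsum := inner_fderiv_add_inner_fderiv_eq_zero (hV.differentiableAt (by simp)).hasFDerivAt
    ((hG.differentiableAt (by simp)).hasFDerivAt.comp w π.hasFDerivAt)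
    (hmem.mono fun w' hw' => (mem_orthogonal_range_coneMap_iff.1 hw').1) x
  simpa [(mem_orthogonal_range_coneMap_iff.1 hmem.self_of_nhds).2] using hsum

theorem inner_fderiv_normal_base (h : IsPolarPair π G V z) (x : Z) :
    ⟪fderiv ℝ V z x, G (π z)⟫_ℝ = 0 :=
  h.eventually_inner_fderiv_normal_base.self_of_nhds x

theorem inner_fderiv_normal_fderiv_base (h : IsPolarPair π G V z) (x : Z) (a : E) :
    ⟪fderiv ℝ V z x, fderiv ℝ G (π z) a⟫_ℝ = -secondForm G (π z) (V z) (π x) a := by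
  have hbase : HasFDerivAt (fun w => fderiv ℝ G (π w) a) _ z :=
    (h.differentiableAt_fderiv_base.hasFDerivAt.comp z π.hasFDerivAt).clm_apply
      (hasFDerivAt_const a z)
  have hsum := inner_fderiv_add_inner_fderiv_eq_zero h.differentiableAt_normal.hasFDerivAt hbase
    (h.normal_mem.mono fun w hw => (mem_orthogonal_range_coneMap_iff.1 hw).2 a) x
  rw [← eq_neg_iff_add_eq_zero, eq_comm, neg_eq_iff_eq_neg] at hsum
  simpa [secondForm_apply] using hsum

theorem secondForm_normal_base (h : IsPolarPair π G V z) :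
    secondForm V z (G (π z)) = (secondForm G (π z) (V z)).compl₁₂ (π : Z →ₗ[ℝ] E) π := by
  ext x y
  have hnormal : HasFDerivAt (fun w => fderiv ℝ V w y) _ z :=
    h.differentiableAt_fderiv_normal.hasFDerivAt.clm_apply (hasFDerivAt_const y z)
  have hsum := inner_fderiv_add_inner_fderiv_eq_zero hnormal
    (h.differentiableAt_base.hasFDerivAt.comp z π.hasFDerivAt)
    (h.eventually_inner_fderiv_normal_base.mono fun w hw => hw y) x
  calc secondForm V z (G (π z)) x y = -⟪fderiv ℝ V z y, fderiv ℝ G (π z) (π x)⟫_ℝ := by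
        rw [secondForm_apply, real_inner_comm, eq_neg_iff_add_eq_zero, add_comm]
        simpa using hsum
    _ = secondForm G (π z) (V z) (π y) (π x) := by
        rw [h.inner_fderiv_normal_fderiv_base, neg_neg]
    _ = secondForm G (π z) (V z) (π x) (π y) :=
        (isSymm_secondForm h.contDiffAt_base (V z)).eq (π y) (π x)

theorem injective_fderiv_normal (h : IsPolarPair π G V z)
    (hH : (secondForm G (π z) (V z)).SeparatingLeft) : Injective (fderiv ℝ V z) := by
  refine (injective_iff_map_eq_zero _).2 fun x hx => h.vertical_eq_zero x (hH _ fun a => ?_) hx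
  rw [← neg_eq_zero, ← h.inner_fderiv_normal_fderiv_base, hx, inner_zero_left]

variable [FiniteDimensional ℝ Z] [FiniteDimensional ℝ W]

theorem orthogonal_range_coneMap_normal (h : IsPolarPair π G V z)
    (hfinrank : Module.finrank ℝ W = Module.finrank ℝ Z + 2) (hinj : Injective (fderiv ℝ V z)) :
    (coneMap (V z) (fderiv ℝ V z)).rangeᗮ = ℝ ∙ G (π z) := by
  have hcone : Injective (coneMap (V z) (fderiv ℝ V z)) :=
    injective_coneMap hinj h.normal_ne_zero
      (mem_orthogonal_range_iff.2 h.inner_normal_fderiv_normal)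
  have hcodim := finrank_add_finrank_orthogonal_range hcone
  rw [Module.finrank_prod, Module.finrank_self] at hcodim
  refine (Submodule.eq_of_le_of_finrank_eq ?_ ?_).symm
  · rw [Submodule.span_singleton_le_iff_mem, mem_orthogonal_range_coneMap_iff, real_inner_comm]
    refine ⟨h.inner_normal_base, fun x => ?_⟩
    rw [real_inner_comm]
    exact h.inner_fderiv_normal_base x
  · rw [finrank_span_singleton h.base_ne_zero]
    omega

theorem range_fderiv_base_le (h : IsPolarPair π G V z)
    (hfinrank : Module.finrank ℝ W = Module.finrank ℝ Z + 2) (hinj : Injective (fderiv ℝ V z)) :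
    (fderiv ℝ G (π z)).range ≤ (fderiv ℝ V z).range := by
  rintro _ ⟨a, rfl⟩
  have hmem : fderiv ℝ G (π z) a ∈ (coneMap (V z) (fderiv ℝ V z)).range := by
    rw [← Submodule.orthogonal_orthogonal (coneMap (V z) (fderiv ℝ V z)).range,
      h.orthogonal_range_coneMap_normal hfinrank hinj,
      Submodule.mem_orthogonal_singleton_iff_inner_right]
    exact h.inner_base_fderiv_base a
  obtain ⟨⟨t, x⟩, htx⟩ := hmem
  have htx' : t • V z + fderiv ℝ V z x = fderiv ℝ G (π z) a := by simpa using htx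
  have ht : t = 0 := by
    have hinner := congrArg (fun w => ⟪V z, w⟫_ℝ) htx'
    simpa [inner_add_right, inner_smul_right, h.inner_normal_fderiv_normal,
      h.inner_normal_fderiv_base, h.normal_ne_zero] using hinner
  exact ⟨x, by simpa [ht] using htx'⟩

end IsPolarPair

section Surface

open LinearMap

variable {ι : Type*} [Fintype ι] [DecidableEq ι] (c : Module.Basis ι ℝ Z)
  (b : Module.Basis (Fin 2) ℝ E)

theorem det_secondForm_ne_zero {G : E → W} {u : E} {ν : W} (hG : ContDiffAt ℝ 2 G u)
    (himm : Injective (fderiv ℝ G u)) (hne : secondForm G u ν ≠ 0)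
    (htr : ((toMatrix₂ b b (firstForm (fderiv ℝ G u : E →ₗ[ℝ] W)))⁻¹ *
      toMatrix₂ b b (secondForm G u ν)).trace = 0) :
    (toMatrix₂ b b (secondForm G u ν)).det ≠ 0 := by
  refine det_ne_zero_of_trace_inv_mul_eq_zero (posDef_toMatrix₂_firstForm b himm)
    (Matrix.IsHermitian.ext fun i j => ?_) (fun h0 => hne ?_) htr
  · rw [toMatrix₂_apply, toMatrix₂_apply, star_trivial]
    exact (isSymm_secondForm hG ν).eq (b j) (b i)
  · rwa [EmbeddingLike.map_eq_zero_iff] at h0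

variable {π : Z →L[ℝ] E} {G : E → W} {V : Z → W} {z : Z}

theorem IsPolarPair.trace_secondForm_normal_base [FiniteDimensional ℝ W]
    (h : IsPolarPair π G V z) (hfinrank : Module.finrank ℝ W = Module.finrank ℝ Z + 2)
    (himm : Injective (fderiv ℝ G (π z))) (hne : secondForm G (π z) (V z) ≠ 0)
    (htr : ((toMatrix₂ b b (firstForm (fderiv ℝ G (π z) : E →ₗ[ℝ] W)))⁻¹ *
      toMatrix₂ b b (secondForm G (π z) (V z))).trace = 0) :
    ((toMatrix₂ c c (firstForm (fderiv ℝ V z : Z →ₗ[ℝ] W)))⁻¹ *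
      toMatrix₂ c c (secondForm V z (G (π z)))).trace = 0 := by
  have := Module.Finite.of_basis c
  have hdet := det_secondForm_ne_zero b h.contDiffAt_base himm hne htr
  have hinj := h.injective_fderiv_normal (separatingLeft_of_det_ne_zero b hdet)
  rw [h.secondForm_normal_base, trace_inv_firstForm_mul_polar b c
    h.inner_fderiv_normal_fderiv_base hinj (h.range_fderiv_base_le hfinrank hinj) hdet]
  have hinv := trace_inv_eq_zero_of_trace_eq_zero htr
  rwa [Matrix.mul_inv_rev, Matrix.nonsing_inv_nonsing_inv _
    (posDef_toMatrix₂_firstForm b himm).det_pos.ne'.isUnit] at hinv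

end Surface

end PolarPair

section Reparametrization

variable {E E' W : Type*} [NormedAddCommGroup E] [NormedSpace ℝ E] [NormedAddCommGroup E']
  [NormedSpace ℝ E'] [NormedAddCommGroup W]

theorem range_coneMap [InnerProductSpace ℝ W] (v : W) (L : E →L[ℝ] W) :
    (coneMap v L).range = (ℝ ∙ v) ⊔ L.range := by
  ext w
  simp only [LinearMap.mem_range, Submodule.mem_sup, Submodule.mem_span_singleton]
  constructor
  · rintro ⟨a, rfl⟩
    exact ⟨_, ⟨a.1, rfl⟩, _, ⟨a.2, rfl⟩, (coneMap_apply v L a).symm⟩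
  · rintro ⟨_, ⟨r, rfl⟩, _, ⟨a, rfl⟩, rfl⟩
    exact ⟨(r, a), coneMap_apply v L (r, a)⟩

theorem range_fderiv_comp [NormedSpace ℝ W] {F : E' → W} {τ : E → E'} {a : E}
    (hF : DifferentiableAt ℝ F (τ a)) (hτ : DifferentiableAt ℝ τ a)
    (hsurj : Surjective (fderiv ℝ τ a)) :
    (fderiv ℝ (F ∘ τ) a).range = (fderiv ℝ F (τ a)).range := by
  rw [fderiv_comp a hF hτ]
  exact LinearMap.range_comp_of_range_eq_top _ (LinearMap.range_eq_top.2 hsurj)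

theorem fderiv_fderiv_comp [NormedSpace ℝ W] {F : E' → W} {τ : E → E'} {a : E}
    (hF : ContDiffAt ℝ 2 F (τ a)) (hτ : ContDiffAt ℝ 2 τ a) (X Y : E) :
    fderiv ℝ (fderiv ℝ (F ∘ τ)) a X Y =
      fderiv ℝ (fderiv ℝ F) (τ a) (fderiv ℝ τ a X) (fderiv ℝ τ a Y) +
        fderiv ℝ F (τ a) (fderiv ℝ (fderiv ℝ τ) a X Y) := by
  have hFdiff : ∀ᶠ y in 𝓝 (τ a), DifferentiableAt ℝ F y :=
    (hF.eventually (by simp)).mono fun y hy => hy.differentiableAt (by simp)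
  have hτdiff : ∀ᶠ x in 𝓝 a, DifferentiableAt ℝ τ x :=
    (hτ.eventually (by simp)).mono fun x hx => hx.differentiableAt (by simp)
  have hchain : fderiv ℝ (F ∘ τ) =ᶠ[𝓝 a] fun x => (fderiv ℝ F (τ x)).comp (fderiv ℝ τ x) := by
    filter_upwards [hτ.continuousAt.eventually hFdiff, hτdiff] with x hFx hτx
    exact fderiv_comp x hFx hτx
  have hF' : HasFDerivAt (fderiv ℝ F) (fderiv ℝ (fderiv ℝ F) (τ a)) (τ a) :=
    ((hF.fderiv_right (m := 1) (by norm_num)).differentiableAt (by simp)).hasFDerivAt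
  have hτ' : HasFDerivAt (fderiv ℝ τ) (fderiv ℝ (fderiv ℝ τ) a) a :=
    ((hτ.fderiv_right (m := 1) (by norm_num)).differentiableAt (by simp)).hasFDerivAt
  have hprod : HasFDerivAt (fun x => (fderiv ℝ F (τ x)).comp (fderiv ℝ τ x)) _ a :=
    (hF'.comp a (hτ.differentiableAt (by simp)).hasFDerivAt).clm_comp hτ'
  rw [hchain.fderiv_eq, hprod.fderiv]
  simp [add_comm]

theorem secondForm_comp_of_mem_orthogonal [InnerProductSpace ℝ W] {F : E' → W} {τ : E → E'} {a : E}
    (hF : ContDiffAt ℝ 2 F (τ a)) (hτ : ContDiffAt ℝ 2 τ a) {ν : W}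
    (hν : ν ∈ (fderiv ℝ F (τ a)).rangeᗮ) :
    secondForm (F ∘ τ) a ν =
      (secondForm F (τ a) ν).compl₁₂ (fderiv ℝ τ a : E →ₗ[ℝ] E') (fderiv ℝ τ a : E →ₗ[ℝ] E') := by
  ext X Y
  change ⟪ν, _⟫_ℝ = ⟪ν, fderiv ℝ (fderiv ℝ F) (τ a) (fderiv ℝ τ a X) (fderiv ℝ τ a Y)⟫_ℝ
  rw [fderiv_fderiv_comp hF hτ, inner_add_right, mem_orthogonal_range_iff.1 hν, add_zero]

end Reparametrization

namespace SphereImmersion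

section LocalRep

open Matrix LinearMap

variable {n : ℕ} {M : Type*} [TopologicalSpace M] [ChartedSpace (EuclideanSpace ℝ (Fin n)) M]

theorem contMDiff_coe_comp {f : M → S5} (hf : ContMDiff (𝓡 n) (𝓡 5) ∞ f) :
    ContMDiff (𝓡 n) 𝓘(ℝ, E6) ∞ (fun x => (f x : E6)) :=
  haveI : Fact (Module.finrank ℝ E6 = 5 + 1) := ⟨finrank_euclideanSpace_fin⟩
  (contMDiff_coe_sphere (n := 5)).comp hf

theorem differential_eq_mfderiv_comp_mfderiv {f : M → S5} (hf : ContMDiff (𝓡 n) (𝓡 5) ∞ f)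
    (p : M) : differential n f p =
      (mfderiv (𝓡 5) 𝓘(ℝ, E6) ((↑) : S5 → E6) (f p)).comp (mfderiv (𝓡 n) (𝓡 5) f p) :=
  haveI : Fact (Module.finrank ℝ E6 = 5 + 1) := ⟨finrank_euclideanSpace_fin⟩
  mfderiv_comp p ((contMDiff_coe_sphere (n := 5) (m := 1)).mdifferentiableAt (by simp))
    (hf.mdifferentiableAt (by simp))

theorem injective_differential_iff {f : M → S5} (hf : ContMDiff (𝓡 n) (𝓡 5) ∞ f) (p : M) :
    Injective (differential n f p) ↔ Injective (mfderiv (𝓡 n) (𝓡 5) f p) := by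
  have : Fact (Module.finrank ℝ E6 = 5 + 1) := ⟨finrank_euclideanSpace_fin⟩
  rw [differential_eq_mfderiv_comp_mfderiv hf]
  have hcoe : Injective (mfderiv (𝓡 5) 𝓘(ℝ, E6) ((↑) : S5 → E6) (f p)) :=
    injective_mvfderiv_subtypeVal_sphere (f p)
  exact hcoe.of_comp_iff (mfderiv (𝓡 n) (𝓡 5) f p)

variable (n) in
/-- The coordinate representation of `f : M → S⁵ ⊂ ℝ⁶` in the preferred chart at `p`. -/
noncomputable def localRep (f : M → S5) (p : M) (u : EuclideanSpace ℝ (Fin n)) : E6 :=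
  f ((extChartAt (𝓡 n) p).symm u)

theorem norm_localRep (f : M → S5) (p : M) (u : EuclideanSpace ℝ (Fin n)) :
    ‖localRep n f p u‖ = 1 :=
  norm_eq_of_mem_sphere _

theorem localRep_extChartAt (f : M → S5) {p q : M} (hp : p ∈ (extChartAt (𝓡 n) q).source) :
    localRep n f q (extChartAt (𝓡 n) q p) = f p := by
  rw [localRep, (extChartAt (𝓡 n) q).left_inv hp]

theorem differential_eq_fderiv {f : M → S5} (hf : ContMDiff (𝓡 n) (𝓡 5) ∞ f) (p : M) :
    differential n f p = fderiv ℝ (localRep n f p) (extChartAt (𝓡 n) p p) := by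
  rw [differential, ((contMDiff_coe_comp hf).contMDiffAt.mdifferentiableAt (by simp)).mfderiv]
  simp only [ModelWithCorners.range_eq_univ, fderivWithin_univ]
  rfl

theorem normalSpace_eq_orthogonal_range_coneMap {f : M → S5} (hf : ContMDiff (𝓡 n) (𝓡 5) ∞ f)
    (p : M) : normalSpace n f p = (coneMap (f p : E6)
      (fderiv ℝ (localRep n f p) (extChartAt (𝓡 n) p p))).rangeᗮ := by
  rw [range_coneMap, ← differential_eq_fderiv hf]
  rfl

theorem inner_secondFundamentalForm {f : M → S5} {p : M} {ν : E6} (hν : ν ∈ normalSpace n f p)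
    (X Y : TangentSpace (𝓡 n) p) : ⟪secondFundamentalForm n f p X Y, ν⟫_ℝ =
      secondForm (localRep n f p) (extChartAt (𝓡 n) p p) ν X Y := by
  rw [secondFundamentalForm, Submodule.inner_starProjection_left_eq_right,
    Submodule.starProjection_eq_self_iff.2 hν, real_inner_comm]
  rfl

variable (n) in
/-- The standard basis of `ℝⁿ`, that is, the coordinate basis `coordVec` of every tangent space. -/
noncomputable def coordBasis : Module.Basis (Fin n) ℝ (EuclideanSpace ℝ (Fin n)) :=
  (EuclideanSpace.basisFun (Fin n) ℝ).toBasis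

theorem coordBasis_apply (p : M) (i : Fin n) : coordBasis n i = coordVec n p i := by
  rw [coordBasis, OrthonormalBasis.coe_toBasis, EuclideanSpace.basisFun_apply, coordVec]

theorem firstFormMatrix_eq_toMatrix₂ {f : M → S5} (hf : ContMDiff (𝓡 n) (𝓡 5) ∞ f) (p : M) :
    firstFormMatrix n f p = toMatrix₂ (coordBasis n) (coordBasis n)
      (firstForm (fderiv ℝ (localRep n f p) (extChartAt (𝓡 n) p p) : _ →ₗ[ℝ] E6)) := by
  ext i j
  rw [toMatrix₂_apply, coordBasis_apply p, coordBasis_apply p, ← differential_eq_fderiv hf]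
  rfl

theorem shapeMatrix_eq {f : M → S5} (hf : ContMDiff (𝓡 n) (𝓡 5) ∞ f) {p : M} {ν : E6}
    (hν : ν ∈ normalSpace n f p) : shapeMatrix n f p ν =
      (toMatrix₂ (coordBasis n) (coordBasis n)
        (firstForm (fderiv ℝ (localRep n f p) (extChartAt (𝓡 n) p p) : _ →ₗ[ℝ] E6)))⁻¹ *
      toMatrix₂ (coordBasis n) (coordBasis n)
        (secondForm (localRep n f p) (extChartAt (𝓡 n) p p) ν) := by
  rw [shapeMatrix, firstFormMatrix_eq_toMatrix₂ hf]
  congr 1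
  ext i j
  rw [of_apply, inner_secondFundamentalForm hν, toMatrix₂_apply, coordBasis_apply p,
    coordBasis_apply p]

theorem meanCurvatureVector_mem_normalSpace (f : M → S5) (p : M) :
    meanCurvatureVector n f p ∈ normalSpace n f p :=
  Submodule.smul_mem _ _ <| Submodule.sum_mem _ fun _ _ => Submodule.sum_mem _ fun _ _ =>
    Submodule.smul_mem _ _ <| Submodule.starProjection_apply_mem _ _

variable [IsManifold (𝓡 n) ∞ M]

theorem contDiffAt_localRep {f : M → S5} (hf : ContMDiff (𝓡 n) (𝓡 5) ∞ f) {q : M}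
    {u : EuclideanSpace ℝ (Fin n)} (hu : u ∈ (extChartAt (𝓡 n) q).target) :
    ContDiffAt ℝ ∞ (localRep n f q) u :=
  ((contMDiff_coe_comp hf).comp_contMDiffOn (contMDiffOn_extChartAt_symm q)).contDiffOn.contDiffAt
    ((isOpen_extChartAt_target q).mem_nhds hu)

theorem inner_meanCurvatureVector {f : M → S5} (hf : ContMDiff (𝓡 n) (𝓡 5) ∞ f) {p : M} {ν : E6}
    (hν : ν ∈ normalSpace n f p) :
    ⟪meanCurvatureVector n f p, ν⟫_ℝ = 1 / n * (shapeMatrix n f p ν).trace := by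
  have hG : ContDiffAt ℝ 2 (localRep n f p) (extChartAt (𝓡 n) p p) :=
    (contDiffAt_localRep hf (mem_extChartAt_target p)).of_le ENat.LEInfty.out
  have hsymm (i j : Fin n) : ⟪secondFundamentalForm n f p (coordVec n p i) (coordVec n p j), ν⟫_ℝ =
      ⟪secondFundamentalForm n f p (coordVec n p j) (coordVec n p i), ν⟫_ℝ := by
    rw [inner_secondFundamentalForm hν, inner_secondFundamentalForm hν]
    exact (isSymm_secondForm hG ν).eq _ _
  simp only [meanCurvatureVector, shapeMatrix, real_inner_smul_left, sum_inner, Matrix.trace,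
    Matrix.diag_apply, Matrix.mul_apply, of_apply]
  exact congrArg _ (Finset.sum_congr rfl fun i _ => Finset.sum_congr rfl fun j _ => by rw [hsymm])

theorem meanCurvatureVector_eq_zero_iff [NeZero n] {f : M → S5}
    (hf : ContMDiff (𝓡 n) (𝓡 5) ∞ f) (p : M) :
    meanCurvatureVector n f p = 0 ↔ ∀ ν ∈ normalSpace n f p, (shapeMatrix n f p ν).trace = 0 := by
  have hn : (1 / n : ℝ) ≠ 0 := one_div_ne_zero (NeZero.ne _)
  constructor
  · intro h ν hν
    have hinner := inner_meanCurvatureVector hf hν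
    rw [h, inner_zero_left] at hinner
    exact (mul_eq_zero.1 hinner.symm).resolve_left hn
  · intro h
    have hmem := meanCurvatureVector_mem_normalSpace (n := n) f p
    rw [← inner_self_eq_zero (𝕜 := ℝ), inner_meanCurvatureVector hf hmem, h _ hmem, mul_zero]

end LocalRep

section CoordChange

variable {n : ℕ} {M : Type*} [TopologicalSpace M] [ChartedSpace (EuclideanSpace ℝ (Fin n)) M]
  {p q : M}

theorem localRep_eventuallyEq_comp (f : M → S5) (hp : p ∈ (extChartAt (𝓡 n) q).source) :
    localRep n f p =ᶠ[𝓝 (extChartAt (𝓡 n) p p)]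
      localRep n f q ∘ (extChartAt (𝓡 n) q ∘ (extChartAt (𝓡 n) p).symm) := by
  have hsource : (extChartAt (𝓡 n) q).source ∈
      𝓝 ((extChartAt (𝓡 n) p).symm (extChartAt (𝓡 n) p p)) := by
    rw [extChartAt_to_inv]
    exact (isOpen_extChartAt_source q).mem_nhds hp
  filter_upwards [(continuousAt_extChartAt_symm p).eventually hsource] with u hu
  exact (localRep_extChartAt f hu).symm

variable [IsManifold (𝓡 n) ∞ M]

theorem contDiffAt_coordChange (hp : p ∈ (extChartAt (𝓡 n) q).source) :
    ContDiffAt ℝ ∞ (extChartAt (𝓡 n) q ∘ (extChartAt (𝓡 n) p).symm) (extChartAt (𝓡 n) p p) := by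
  have hdom : extChartAt (𝓡 n) p p ∈
      ((extChartAt (𝓡 n) p).symm ≫ extChartAt (𝓡 n) q).source := by
    rw [PartialEquiv.trans_source, PartialEquiv.symm_source]
    exact ⟨mem_extChartAt_target p, by rwa [mem_preimage, extChartAt_to_inv]⟩
  simpa only [ModelWithCorners.range_eq_univ, contDiffWithinAt_univ] using
    contDiffWithinAt_ext_coord_change (I := 𝓡 n) (n := ∞) q p hdom

theorem surjective_fderiv_coordChange (hp : p ∈ (extChartAt (𝓡 n) q).source) :
    Surjective (fderiv ℝ (extChartAt (𝓡 n) q ∘ (extChartAt (𝓡 n) p).symm)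
      (extChartAt (𝓡 n) p p)) := by
  have hfderiv : fderiv ℝ (extChartAt (𝓡 n) q ∘ (extChartAt (𝓡 n) p).symm) (extChartAt (𝓡 n) p p) =
      tangentCoordChange (𝓡 n) p q p := by
    rw [tangentCoordChange_def, ModelWithCorners.range_eq_univ, fderivWithin_univ]
  intro v
  refine ⟨tangentCoordChange (𝓡 n) q p p v, ?_⟩
  rw [hfderiv, tangentCoordChange_comp ⟨⟨hp, mem_extChartAt_source p⟩, hp⟩,
    tangentCoordChange_self hp]

variable {f : M → S5}

theorem normalSpace_eq_of_mem_source (hf : ContMDiff (𝓡 n) (𝓡 5) ∞ f)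
    (hp : p ∈ (extChartAt (𝓡 n) q).source) :
    normalSpace n f p = (coneMap (localRep n f q (extChartAt (𝓡 n) q p))
      (fderiv ℝ (localRep n f q) (extChartAt (𝓡 n) q p))).rangeᗮ := by
  have hG := contDiffAt_localRep hf ((extChartAt (𝓡 n) q).map_source hp)
  have hu : (extChartAt (𝓡 n) q ∘ (extChartAt (𝓡 n) p).symm) (extChartAt (𝓡 n) p p) =
      extChartAt (𝓡 n) q p := by rw [comp_apply, extChartAt_to_inv]
  rw [← hu] at hG
  rw [normalSpace_eq_orthogonal_range_coneMap hf, range_coneMap, range_coneMap,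
    (localRep_eventuallyEq_comp f hp).fderiv_eq, localRep_extChartAt f hp,
    range_fderiv_comp (hG.differentiableAt (by simp))
      ((contDiffAt_coordChange hp).differentiableAt (by simp)) (surjective_fderiv_coordChange hp),
    hu]

theorem secondForm_localRep_ne_zero_iff (hf : ContMDiff (𝓡 n) (𝓡 5) ∞ f)
    (hp : p ∈ (extChartAt (𝓡 n) q).source) {ν : E6} (hν : ν ∈ normalSpace n f p) :
    secondForm (localRep n f p) (extChartAt (𝓡 n) p p) ν ≠ 0 ↔
      secondForm (localRep n f q) (extChartAt (𝓡 n) q p) ν ≠ 0 := by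
  have hG := contDiffAt_localRep hf ((extChartAt (𝓡 n) q).map_source hp)
  have hu : (extChartAt (𝓡 n) q ∘ (extChartAt (𝓡 n) p).symm) (extChartAt (𝓡 n) p p) =
      extChartAt (𝓡 n) q p := by rw [comp_apply, extChartAt_to_inv]
  rw [normalSpace_eq_of_mem_source hf hp, range_coneMap, ← hu] at hν
  have hform : secondForm (localRep n f p) (extChartAt (𝓡 n) p p) ν =
      secondForm (localRep n f q ∘ (extChartAt (𝓡 n) q ∘ (extChartAt (𝓡 n) p).symm))
        (extChartAt (𝓡 n) p p) ν := by
    ext X Y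
    simp only [secondForm_apply, (localRep_eventuallyEq_comp f hp).fderiv.fderiv_eq]
  have h2 : (2 : ℕ∞ω) ≤ ∞ := ENat.LEInfty.out
  rw [hform, secondForm_comp_of_mem_orthogonal (hu ▸ hG.of_le h2)
    ((contDiffAt_coordChange hp).of_le h2) (Submodule.orthogonal_le le_sup_right hν), hu]
  have hsurj := surjective_fderiv_coordChange hp
  refine not_congr ⟨fun h => ?_, fun h => by rw [h]; rfl⟩
  ext X Y
  obtain ⟨X, rfl⟩ := hsurj X
  obtain ⟨Y, rfl⟩ := hsurj Y
  exact LinearMap.congr_fun₂ h X Y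

end CoordChange

section StarBundle

variable {M : Type*} [TopologicalSpace M] [ChartedSpace (EuclideanSpace ℝ (Fin 2)) M]

theorem mem_orthogonal_secondFormImage_iff {g : M → S5} {p : M} {V : E6}
    (hV : V ∈ normalSpace 2 g p) :
    V ∈ (secondFormImage g p)ᗮ ↔ secondForm (localRep 2 g p) (extChartAt (𝓡 2) p p) V = 0 := by
  have horth : V ∈ (secondFormImage g p)ᗮ ↔ ∀ X Y, ⟪secondFundamentalForm 2 g p X Y, V⟫_ℝ = 0 := by
    rw [secondFormImage, ← Submodule.span_singleton_le_iff_mem, ← Submodule.isOrtho_iff_le,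
      Submodule.isOrtho_comm, Submodule.isOrtho_span]
    exact ⟨fun h X Y => h ⟨X, Y, rfl⟩ (mem_singleton V),
      fun h _ ⟨X, Y, hw⟩ _ hv => by rw [hw, mem_singleton_iff.1 hv, h]⟩
  simp only [horth, inner_secondFundamentalForm hV]
  exact ⟨fun h => LinearMap.ext₂ h, fun h X Y => by rw [h]; rfl⟩

variable [IsManifold (𝓡 2) ∞ M] {g : M → S5}

theorem mem_starBundle_iff (hg : ContMDiff (𝓡 2) (𝓡 5) ∞ g) {x : M × E6} {q : M}
    (hx : x.1 ∈ (extChartAt (𝓡 2) q).source) :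
    x ∈ starBundle g ↔ x ∈ unitNormalBundle g ∧
      secondForm (localRep 2 g q) (extChartAt (𝓡 2) q x.1) x.2 ≠ 0 :=
  and_congr_right fun h => by
    rw [mem_orthogonal_secondFormImage_iff h.2, ← ne_eq, secondForm_localRep_ne_zero_iff hg hx h.2]

theorem isOpen_starBundle (hg : ContMDiff (𝓡 2) (𝓡 5) ∞ g) :
    IsOpen {x : unitNormalBundle g | (x : M × E6) ∈ starBundle g} := by
  rw [isOpen_iff_mem_nhds]
  intro x hx
  let G := localRep 2 g x.1.1
  let φ := extChartAt (𝓡 2) x.1.1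
  obtain ⟨-, hform⟩ := (mem_starBundle_iff hg (mem_extChartAt_source x.1.1)).1 hx
  obtain ⟨a, b, hab⟩ : ∃ a b, secondForm G (φ x.1.1) x.1.2 a b ≠ 0 := by
    by_contra! h
    exact hform (LinearMap.ext₂ h)
  have hfst : ContinuousAt (fun y : unitNormalBundle g => y.1.1) x := by fun_prop
  have hD2 : ContinuousAt (fderiv ℝ (fderiv ℝ G)) (φ x.1.1) :=
    (((contDiffAt_localRep hg (mem_extChartAt_target x.1.1)).fderiv_right (m := ∞)
      (by simp)).fderiv_right (m := 0) (by simp)).continuousAt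
  have hφ : ContinuousAt (fun y : unitNormalBundle g => φ y.1.1) x :=
    (continuousAt_extChartAt x.1.1).comp (f := fun y : unitNormalBundle g => y.1.1) hfst
  have hcont : ContinuousAt (fun y : unitNormalBundle g => secondForm G (φ y.1.1) y.1.2 a b) x :=
    (continuous_snd.comp continuous_subtype_val).continuousAt.inner
      (((hD2.comp (f := fun y : unitNormalBundle g => φ y.1.1) hφ).clm_apply
        continuousAt_const).clm_apply continuousAt_const)
  filter_upwards [hfst.eventually_mem (extChartAt_source_mem_nhds (I := 𝓡 2) x.1.1),
    hcont.eventually_ne hab] with y hy hne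
  exact (mem_starBundle_iff hg hy).2 ⟨y.2, fun h => hne (by rw [h]; rfl)⟩

end StarBundle

section ConeRep

variable {n : ℕ} {M : Type*} [TopologicalSpace M] [ChartedSpace (EuclideanSpace ℝ (Fin n)) M]

variable (n) in
/-- The differential of the cone over `f : M → S⁵` in the preferred chart at `q`: its range is
`ℝ f ⊕ f_* TM`, as a subspace of `ℝ⁶` depending on the coordinates. -/
noncomputable def coneRep (f : M → S5) (q : M) (u : EuclideanSpace ℝ (Fin n)) :
    ℝ × EuclideanSpace ℝ (Fin n) →L[ℝ] E6 :=
  coneMap (localRep n f q u) (fderiv ℝ (localRep n f q) u)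

variable [IsManifold (𝓡 n) ∞ M] {f : M → S5}

theorem contDiffAt_coneRep (hf : ContMDiff (𝓡 n) (𝓡 5) ∞ f) {q : M} {u : EuclideanSpace ℝ (Fin n)}
    (hu : u ∈ (extChartAt (𝓡 n) q).target) : ContDiffAt ℝ ∞ (coneRep n f q) u := by
  have hG := contDiffAt_localRep hf hu
  exact ContDiffAt.comp (f := fun u => (localRep n f q u, fderiv ℝ (localRep n f q) u)) u
    contDiff_coneMap.contDiffAt (hG.prodMk (hG.fderiv_right (by simp)))

theorem injective_coneRep (hf : ContMDiff (𝓡 n) (𝓡 5) ∞ f) {q : M}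
    (hinj : Injective (differential n f q)) :
    Injective (coneRep n f q (extChartAt (𝓡 n) q q)) := by
  have hG := contDiffAt_localRep hf (mem_extChartAt_target q)
  rw [differential_eq_fderiv hf] at hinj
  refine injective_coneMap hinj (norm_ne_zero_iff.1 ?_) (mem_orthogonal_range_iff.2 ?_)
  · rw [norm_localRep]
    exact one_ne_zero
  · exact inner_fderiv_eq_zero_of_norm_eq (hG.differentiableAt (by simp))
      (.of_forall (norm_localRep f q))

end ConeRep

section NormalBundleChart

variable {M : Type*} [TopologicalSpace M] [ChartedSpace (EuclideanSpace ℝ (Fin 2)) M]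

/-- The splitting `ℝ⁴ = ℝ² × ℝ²` into coordinates on the surface and on the fibres of the unit
normal bundle. -/
noncomputable def splitCoord :
    EuclideanSpace ℝ (Fin 4) ≃L[ℝ] EuclideanSpace ℝ (Fin 2) × EuclideanSpace ℝ (Fin 2) :=
  EuclideanSpace.finAddEquivProd (n := 2) (m := 2)

/-- The coordinates on the surface. -/
noncomputable def baseCoord : EuclideanSpace ℝ (Fin 4) →L[ℝ] EuclideanSpace ℝ (Fin 2) :=
  (ContinuousLinearMap.fst ℝ (EuclideanSpace ℝ (Fin 2)) (EuclideanSpace ℝ (Fin 2))).comp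
    splitCoord.toContinuousLinearMap

variable (g : M → S5) (q : M) (V₀ : E6) (T : E6 →L[ℝ] EuclideanSpace ℝ (Fin 2))

/-- The coordinates of the points above which `unitNormalRep g q V₀ T` is defined. -/
def frameDomain : Set (EuclideanSpace ℝ (Fin 2)) :=
  (extChartAt (𝓡 2) q).target ∩ {u | (frameMap V₀ T (coneRep 2 g q u)).IsInvertible}

/-- The unit normals of `g`, near `q` and in the half space `0 < ⟪V₀, ·⟫`, in terms of coordinates
on the surface and on the fibres of the unit normal bundle. -/
noncomputable def unitNormalRep (z : EuclideanSpace ℝ (Fin 4)) : E6 :=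
  unitNormal V₀ T (coneRep 2 g q (baseCoord z)) (splitCoord z).2

variable {g q V₀ T} [IsManifold (𝓡 2) ∞ M]

theorem unitNormalRep_mem_normalSpace (hg : ContMDiff (𝓡 2) (𝓡 5) ∞ g)
    {z : EuclideanSpace ℝ (Fin 4)} (hz : baseCoord z ∈ frameDomain g q V₀ T) :
    unitNormalRep g q V₀ T z ∈ normalSpace 2 g ((extChartAt (𝓡 2) q).symm (baseCoord z)) := by
  rw [normalSpace_eq_of_mem_source hg ((extChartAt (𝓡 2) q).map_target hz.1),
    (extChartAt (𝓡 2) q).right_inv hz.1]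
  exact unitNormal_mem_orthogonal hz.2 _

theorem isOpen_frameDomain (hg : ContMDiff (𝓡 2) (𝓡 5) ∞ g) : IsOpen (frameDomain g q V₀ T) :=
  ContinuousOn.isOpen_inter_preimage (f := fun u => frameMap V₀ T (coneRep 2 g q u))
    (fun _ hu => (((contDiff_frameMap V₀ T (n := ∞)).continuous.continuousAt).comp
      (contDiffAt_coneRep hg hu).continuousAt).continuousWithinAt)
    (isOpen_extChartAt_target q) ContinuousLinearEquiv.isOpen

theorem contDiffAt_unitNormalRep (hg : ContMDiff (𝓡 2) (𝓡 5) ∞ g) {z : EuclideanSpace ℝ (Fin 4)}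
    (hz : baseCoord z ∈ frameDomain g q V₀ T) : ContDiffAt ℝ ∞ (unitNormalRep g q V₀ T) z :=
  ContDiffAt.comp (f := fun z => (coneRep 2 g q (baseCoord z), (splitCoord z).2)) z
    (contDiffAt_unitNormal hz.2)
    (((contDiffAt_coneRep hg hz.1).comp z baseCoord.contDiff.contDiffAt).prodMk
      (contDiff_snd.comp splitCoord.contDiff).contDiffAt)

theorem contMDiffOn_prodMk_normalCoord :
    ContMDiffOn ((𝓡 2).prod 𝓘(ℝ, E6)) 𝓘(ℝ, EuclideanSpace ℝ (Fin 4)) ∞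
      (fun x : M × E6 => splitCoord.symm (extChartAt (𝓡 2) q x.1, normalCoord V₀ T x.2))
      {x | x.1 ∈ (extChartAt (𝓡 2) q).source ∧ 0 < ⟪V₀, x.2⟫_ℝ} := by
  refine splitCoord.symm.contDiff.contMDiff.comp_contMDiffOn (.prodMk_space ?_ ?_)
  · exact contMDiffOn_extChartAt.comp contMDiffOn_fst fun x hx => by simpa using hx.1
  · have hcoord : ContDiffOn ℝ ∞ (normalCoord V₀ T) {V | 0 < ⟪V₀, V⟫_ℝ} :=
      ((contDiff_const.inner ℝ contDiff_id).contDiffOn.inv fun V hV => ne_of_gt hV).smul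
        T.contDiff.contDiffOn
    exact hcoord.contMDiffOn.comp contMDiffOn_snd fun x hx => hx.2

variable (q V₀ T) in
/-- The chart of the unit normal bundle of `g` near `q`, in the half space `0 < ⟪V₀, ·⟫`, whose
inverse is given by `unitNormalRep`. -/
noncomputable def unitNormalBundleChart (hg : ContMDiff (𝓡 2) (𝓡 5) ∞ g) :
    SubmanifoldChart (EuclideanSpace ℝ (Fin 4)) ((𝓡 2).prod 𝓘(ℝ, E6)) ∞ (unitNormalBundle g) where
  coord x := splitCoord.symm (extChartAt (𝓡 2) q x.1, normalCoord V₀ T x.2)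
  param z := ((extChartAt (𝓡 2) q).symm (baseCoord z), unitNormalRep g q V₀ T z)
  source := ((extChartAt (𝓡 2) q).source ∩ extChartAt (𝓡 2) q ⁻¹' frameDomain g q V₀ T) ×ˢ
    {V | 0 < ⟪V₀, V⟫_ℝ}
  target := baseCoord ⁻¹' frameDomain g q V₀ T
  isOpen_source := ((continuousOn_extChartAt q).isOpen_inter_preimage (isOpen_extChartAt_source q)
    (isOpen_frameDomain hg)).prod (isOpen_lt continuous_const (by fun_prop))
  isOpen_target := (isOpen_frameDomain hg).preimage baseCoord.continuous
  contMDiffOn_coord := contMDiffOn_prodMk_normalCoord.mono fun _ hx => ⟨hx.1.1, hx.2⟩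
  contMDiffOn_param := .prodMk
    ((contMDiffOn_extChartAt_symm q).comp baseCoord.contMDiff.contMDiffOn fun _ hz => hz.1)
    fun _ hz => (contDiffAt_unitNormalRep hg hz).contMDiffAt.contMDiffWithinAt
  coord_mem_target x _ hx := by simpa [baseCoord] using hx.1.2
  param_mem _ hz := ⟨norm_unitNormal hz.2 _, unitNormalRep_mem_normalSpace hg hz⟩
  param_mem_source _ hz := ⟨⟨(extChartAt (𝓡 2) q).map_target hz.1, by
    rwa [mem_preimage, (extChartAt (𝓡 2) q).right_inv hz.1]⟩, inner_unitNormal_pos hz.2 _⟩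
  param_coord x hxN hx := by
    have hV := hxN.2
    rw [normalSpace_eq_of_mem_source hg hx.1.1] at hV
    simp only [unitNormalRep, baseCoord, ContinuousLinearMap.comp_apply,
      ContinuousLinearEquiv.coe_coe, splitCoord.apply_symm_apply, ContinuousLinearMap.coe_fst']
    rw [(extChartAt (𝓡 2) q).left_inv hx.1.1,
      unitNormal_normalCoord hx.1.2.2 hxN.1 hV hx.2]
  coord_param z hz := by
    rw [(extChartAt (𝓡 2) q).right_inv hz.1, unitNormalRep, normalCoord_unitNormal hz.2,
      splitCoord.symm_apply_eq]
    rfl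

theorem exists_mem_source_unitNormalBundleChart (hg : ContMDiff (𝓡 2) (𝓡 5) ∞ g)
    (hinj : ∀ p, Injective (differential 2 g p)) {x : M × E6} (hx : x ∈ unitNormalBundle g) :
    ∃ T, x ∈ (unitNormalBundleChart x.1 x.2 T hg).source := by
  have hV : x.2 ≠ 0 := norm_ne_zero_iff.1 (hx.1 ▸ one_ne_zero)
  obtain ⟨T, hT⟩ := exists_isInvertible_frameMap (F := EuclideanSpace ℝ (Fin 2))
    (injective_coneRep hg (hinj x.1)) hV
    (normalSpace_eq_of_mem_source hg (mem_extChartAt_source x.1) ▸ hx.2) (by simp)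
  exact ⟨T, ⟨mem_extChartAt_source x.1, mem_extChartAt_target x.1, hT⟩, real_inner_self_pos.2 hV⟩

theorem isPolarPair_unitNormalRep (hg : ContMDiff (𝓡 2) (𝓡 5) ∞ g) {z : EuclideanSpace ℝ (Fin 4)}
    (hz : baseCoord z ∈ frameDomain g q V₀ T) :
    IsPolarPair baseCoord (localRep 2 g q) (unitNormalRep g q V₀ T) z := by
  have hdom : ∀ᶠ w in 𝓝 z, baseCoord w ∈ frameDomain g q V₀ T :=
    baseCoord.continuous.continuousAt.eventually ((isOpen_frameDomain hg).mem_nhds hz)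
  have hV : ContDiffAt ℝ 2 (unitNormalRep g q V₀ T) z :=
    (contDiffAt_unitNormalRep hg hz).of_le ENat.LEInfty.out
  refine ⟨(contDiffAt_localRep hg hz.1).of_le ENat.LEInfty.out, hV,
    .of_forall (norm_localRep g q), hdom.mono fun w hw => norm_unitNormal hw.2 _,
    hdom.mono fun w hw => unitNormal_mem_orthogonal hw.2 _, fun x hbase hnormal => ?_⟩
  have hcoord : DifferentiableAt ℝ (normalCoord V₀ T) (unitNormalRep g q V₀ T z) :=
    (((differentiableAt_const V₀).inner ℝ differentiableAt_id).inv
      (inner_unitNormal_pos hz.2 _).ne').smul T.differentiableAt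
  have hfibre : HasFDerivAt (fun w => (splitCoord w).2) _ z :=
    (hcoord.hasFDerivAt.comp z (hV.differentiableAt (by simp)).hasFDerivAt).congr_of_eventuallyEq
      (hdom.mono fun w hw => (normalCoord_unitNormal hw.2 _).symm)
  have hsnd : (splitCoord x).2 = 0 := by
    have hunique := hfibre.unique (hasFDerivAt_snd.comp z splitCoord.hasFDerivAt)
    simpa [hnormal] using (DFunLike.congr_fun hunique x).symm
  exact splitCoord.map_eq_zero_iff.1 (Prod.ext hbase hsnd)

end NormalBundleChart

section Immersion

variable {n : ℕ} {M : Type*} [TopologicalSpace M] [ChartedSpace (EuclideanSpace ℝ (Fin n)) M]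

theorem shapeMatrix_smul (f : M → S5) (p : M) (t : ℝ) (ν : E6) :
    shapeMatrix n f p (t • ν) = t • shapeMatrix n f p ν := by
  rw [shapeMatrix, shapeMatrix, ← mul_smul_comm]
  congr 1
  ext i j
  simp [inner_smul_right]

variable {f : M → S5}

theorem IsMinimalImmersion.contMDiff (hf : IsMinimalImmersion n f) : ContMDiff (𝓡 n) (𝓡 5) ∞ f :=
  hf.1.contMDiff

theorem IsMinimalImmersion.injective_differential (hf : IsMinimalImmersion n f) (p : M) :
    Injective (differential n f p) :=
  (injective_differential_iff hf.contMDiff p).2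
    (injective_mfderiv_of_isImmersionAt (n := ∞) (by simp) (hf.1.isImmersionAt p))

end Immersion

section PolarFamily

open Matrix LinearMap

variable {M N : Type*} [TopologicalSpace M] [ChartedSpace (EuclideanSpace ℝ (Fin 2)) M]
  [TopologicalSpace N] [ChartedSpace (EuclideanSpace ℝ (Fin 4)) N]

/-- Near `q`, the map `f : N⁴ → S⁵` is, in the preferred charts, a family of unit normals of
`g : M² → S⁵` as in `IsPolarPair`, and the second fundamental form of `g` at `p` in the direction
`f q` is not zero. -/
structure IsPolarAt (π : EuclideanSpace ℝ (Fin 4) →L[ℝ] EuclideanSpace ℝ (Fin 2)) (g : M → S5)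
    (p : M) (f : N → S5) (q : N) : Prop where
  map_extChartAt : π (extChartAt (𝓡 4) q q) = extChartAt (𝓡 2) p p
  isPolarPair : IsPolarPair π (localRep 2 g p) (localRep 4 f q) (extChartAt (𝓡 4) q q)
  secondForm_ne_zero : secondForm (localRep 2 g p) (extChartAt (𝓡 2) p p) (f q) ≠ 0

namespace IsPolarAt

variable {π : EuclideanSpace ℝ (Fin 4) →L[ℝ] EuclideanSpace ℝ (Fin 2)} {g : M → S5} {p : M}
  {f : N → S5} {q : N}

theorem localRep_base (h : IsPolarAt π g p f q) :
    localRep 2 g p (π (extChartAt (𝓡 4) q q)) = g p := by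
  rw [h.map_extChartAt, localRep_extChartAt g (mem_extChartAt_source p)]

variable [IsManifold (𝓡 2) ∞ M]

theorem mem_normalSpace_base (h : IsPolarAt π g p f q) (hg : ContMDiff (𝓡 2) (𝓡 5) ∞ g) :
    (f q : E6) ∈ normalSpace 2 g p := by
  have hmem := h.isPolarPair.normal_mem.self_of_nhds
  rwa [localRep_extChartAt f (mem_extChartAt_source q), h.map_extChartAt,
    ← normalSpace_eq_of_mem_source hg (mem_extChartAt_source p)] at hmem

theorem trace_inv_firstForm_mul_secondForm (h : IsPolarAt π g p f q)
    (hg : ContMDiff (𝓡 2) (𝓡 5) ∞ g) (hmin : meanCurvatureVector 2 g p = 0) :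
    ((toMatrix₂ (coordBasis 2) (coordBasis 2)
        (firstForm (fderiv ℝ (localRep 2 g p) (extChartAt (𝓡 2) p p) : _ →ₗ[ℝ] E6)))⁻¹ *
      toMatrix₂ (coordBasis 2) (coordBasis 2)
        (secondForm (localRep 2 g p) (extChartAt (𝓡 2) p p) (f q))).trace = 0 := by
  rw [← shapeMatrix_eq hg (h.mem_normalSpace_base hg)]
  exact (meanCurvatureVector_eq_zero_iff hg p).1 hmin _ (h.mem_normalSpace_base hg)

theorem injective_fderiv (h : IsPolarAt π g p f q) (hg : ContMDiff (𝓡 2) (𝓡 5) ∞ g)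
    (himm : Injective (differential 2 g p)) (hmin : meanCurvatureVector 2 g p = 0) :
    Injective (fderiv ℝ (localRep 4 f q) (extChartAt (𝓡 4) q q)) := by
  refine h.isPolarPair.injective_fderiv_normal ?_
  rw [h.map_extChartAt, localRep_extChartAt f (mem_extChartAt_source q)]
  refine separatingLeft_of_det_ne_zero (coordBasis 2) (det_secondForm_ne_zero (coordBasis 2)
    ?_ ?_ h.secondForm_ne_zero (h.trace_inv_firstForm_mul_secondForm hg hmin))
  · exact h.map_extChartAt ▸ h.isPolarPair.contDiffAt_base
  · rwa [← differential_eq_fderiv hg]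

theorem normalSpace_eq (h : IsPolarAt π g p f q) (hg : ContMDiff (𝓡 2) (𝓡 5) ∞ g)
    (hf : ContMDiff (𝓡 4) (𝓡 5) ∞ f) (himm : Injective (differential 2 g p))
    (hmin : meanCurvatureVector 2 g p = 0) : normalSpace 4 f q = ℝ ∙ (g p : E6) := by
  rw [normalSpace_eq_orthogonal_range_coneMap hf,
    ← localRep_extChartAt (n := 4) f (mem_extChartAt_source q), ← h.localRep_base]
  exact h.isPolarPair.orthogonal_range_coneMap_normal (by simp) (h.injective_fderiv hg himm hmin)

theorem base_mem_normalSpace (h : IsPolarAt π g p f q) (hg : ContMDiff (𝓡 2) (𝓡 5) ∞ g)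
    (hf : ContMDiff (𝓡 4) (𝓡 5) ∞ f) (himm : Injective (differential 2 g p))
    (hmin : meanCurvatureVector 2 g p = 0) : (g p : E6) ∈ normalSpace 4 f q := by
  rw [h.normalSpace_eq hg hf himm hmin]
  exact Submodule.mem_span_singleton_self _

theorem exists_shapeMatrix_eq_mul (h : IsPolarAt π g p f q) (hg : ContMDiff (𝓡 2) (𝓡 5) ∞ g)
    (hf : ContMDiff (𝓡 4) (𝓡 5) ∞ f) (himm : Injective (differential 2 g p))
    (hmin : meanCurvatureVector 2 g p = 0) :
    ∃ (A : Matrix (Fin 4) (Fin 2) ℝ) (B : Matrix (Fin 2) (Fin 4) ℝ),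
      shapeMatrix 4 f q (g p) = A * B := by
  rw [shapeMatrix_eq hf (h.base_mem_normalSpace hg hf himm hmin), ← h.localRep_base,
    h.isPolarPair.secondForm_normal_base,
    toMatrix₂_compl₁₂ (coordBasis 2) (coordBasis 2) (coordBasis 4) (coordBasis 4)]
  exact ⟨_, _, (Matrix.mul_assoc _ _ _).symm⟩

theorem rMeanCurvature_eq_zero (h : IsPolarAt π g p f q) (hg : ContMDiff (𝓡 2) (𝓡 5) ∞ g)
    (hf : ContMDiff (𝓡 4) (𝓡 5) ∞ f) (himm : Injective (differential 2 g p))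
    (hmin : meanCurvatureVector 2 g p = 0) {r : ℕ} (hr : 2 < r) {ν : E6}
    (hν : ν ∈ normalSpace 4 f q) : rMeanCurvature 4 r f q ν = 0 := by
  rw [h.normalSpace_eq hg hf himm hmin] at hν
  obtain ⟨t, rfl⟩ := Submodule.mem_span_singleton.1 hν
  obtain ⟨A, B, hAB⟩ := h.exists_shapeMatrix_eq_mul hg hf himm hmin
  rw [rMeanCurvature, principalCurvatures, shapeMatrix_smul, hAB, ← Matrix.smul_mul,
    esymm_roots_charpoly_mul_eq_zero _ _ (by simpa using hr), zero_div]

theorem meanCurvatureVector_eq_zero [IsManifold (𝓡 4) ∞ N] (h : IsPolarAt π g p f q)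
    (hg : ContMDiff (𝓡 2) (𝓡 5) ∞ g) (hf : ContMDiff (𝓡 4) (𝓡 5) ∞ f)
    (himm : Injective (differential 2 g p)) (hmin : meanCurvatureVector 2 g p = 0) :
    meanCurvatureVector 4 f q = 0 := by
  refine (meanCurvatureVector_eq_zero_iff hf q).2 fun ν hν => ?_
  rw [h.normalSpace_eq hg hf himm hmin] at hν
  obtain ⟨t, rfl⟩ := Submodule.mem_span_singleton.1 hν
  have htrace := h.isPolarPair.trace_secondForm_normal_base (coordBasis 4) (coordBasis 2) (by simp)
    (by rwa [h.map_extChartAt, ← differential_eq_fderiv hg])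
    (by simpa only [h.map_extChartAt, localRep_extChartAt f (mem_extChartAt_source q)]
      using h.secondForm_ne_zero)
    (by simpa only [h.map_extChartAt, localRep_extChartAt f (mem_extChartAt_source q)]
      using h.trace_inv_firstForm_mul_secondForm hg hmin)
  rw [h.localRep_base] at htrace
  rw [shapeMatrix_smul, Matrix.trace_smul,
    shapeMatrix_eq hf (h.base_mem_normalSpace hg hf himm hmin), htrace, smul_zero]

end IsPolarAt

end PolarFamily

section PolarMap

variable {M : Type*} [TopologicalSpace M] [ChartedSpace (EuclideanSpace ℝ (Fin 2)) M]
  [IsManifold (𝓡 2) ∞ M] {g : M → S5}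

/-- The coordinate function `T` on the fibres for which `unitNormalBundleChart` is a chart at
`x`. -/
noncomputable def fibreCoord (hg : IsMinimalImmersion 2 g) (x : starBundle g) :
    E6 →L[ℝ] EuclideanSpace ℝ (Fin 2) :=
  Classical.choose (exists_mem_source_unitNormalBundleChart hg.contMDiff hg.injective_differential
    x.2.1)

/-- The chart of `N_*` at `x`. -/
noncomputable def starBundleChart (hg : IsMinimalImmersion 2 g) (x : starBundle g) :
    SubmanifoldChart (EuclideanSpace ℝ (Fin 4)) ((𝓡 2).prod 𝓘(ℝ, E6)) ∞ (starBundle g) :=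
  (unitNormalBundleChart x.1.1 x.1.2 (fibreCoord hg x) hg.contMDiff).restrict
    (fun _ hy => hy.1) (isOpen_starBundle hg.contMDiff)

theorem mem_source_starBundleChart (hg : IsMinimalImmersion 2 g) (x : starBundle g) :
    (x : M × E6) ∈ (starBundleChart hg x).source :=
  Classical.choose_spec (exists_mem_source_unitNormalBundleChart hg.contMDiff
    hg.injective_differential x.2.1)

/-- The differentiable structure of `N_*`. -/
noncomputable abbrev starBundleChartedSpace (hg : IsMinimalImmersion 2 g) :
    ChartedSpace (EuclideanSpace ℝ (Fin 4)) (starBundle g) :=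
  SubmanifoldChart.chartedSpace (starBundleChart hg) (mem_source_starBundleChart hg)

theorem contMDiff_polarMap (hg : IsMinimalImmersion 2 g) :
    letI := starBundleChartedSpace hg
    ContMDiff (𝓡 4) (𝓡 5) ∞ (polarMap g) := by
  let := starBundleChartedSpace hg
  have : Fact (Module.finrank ℝ E6 = 5 + 1) := ⟨finrank_euclideanSpace_fin⟩
  have := SubmanifoldChart.isManifold (starBundleChart hg) (mem_source_starBundleChart hg)
  have hval := SubmanifoldChart.contMDiff_val (starBundleChart hg) (mem_source_starBundleChart hg)
  exact (contMDiff_snd.comp hval).codRestrict_sphere (n := 5) _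

theorem localRep_polarMap_eventuallyEq (hg : IsMinimalImmersion 2 g) (x : starBundle g) :
    letI := starBundleChartedSpace hg
    localRep 4 (polarMap g) x =ᶠ[𝓝 (extChartAt (𝓡 4) x x)]
      unitNormalRep g x.1.1 x.1.2 (fibreCoord hg x) := by
  let := starBundleChartedSpace hg
  filter_upwards [(starBundleChart hg x).isOpen_target.mem_nhds
    ((starBundleChart hg x).coord_mem_target x.2 (mem_source_starBundleChart hg x))] with z hz
  exact congrArg Prod.snd ((starBundleChart hg x).coe_toChart_symm x hz)

theorem isPolarAt_polarMap (hg : IsMinimalImmersion 2 g) (x : starBundle g) :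
    letI := starBundleChartedSpace hg
    IsPolarAt baseCoord g x.1.1 (polarMap g) x := by
  let := starBundleChartedSpace hg
  have hbase : baseCoord (extChartAt (𝓡 4) x x) = extChartAt (𝓡 2) x.1.1 x.1.1 :=
    congrArg Prod.fst (splitCoord.apply_symm_apply _)
  refine ⟨hbase, ?_, ((mem_starBundle_iff hg.contMDiff (mem_extChartAt_source x.1.1)).1 x.2).2⟩
  refine (isPolarPair_unitNormalRep hg.contMDiff ?_).congr_normal
    (localRep_polarMap_eventuallyEq hg x)
  rw [hbase]
  exact (mem_source_starBundleChart hg x).1.2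

theorem isMinimalImmersion_polarMap (hg : IsMinimalImmersion 2 g) :
    letI := starBundleChartedSpace hg
    IsMinimalImmersion 4 (polarMap g) := by
  let := starBundleChartedSpace hg
  have := SubmanifoldChart.isManifold (starBundleChart hg) (mem_source_starBundleChart hg)
  have hf := contMDiff_polarMap hg
  refine ⟨isImmersion_of_injective_mfderiv (by simp) hf fun x => ?_, fun x => ?_⟩
  · rw [← injective_differential_iff hf, differential_eq_fderiv hf]
    exact (isPolarAt_polarMap hg x).injective_fderiv hg.contMDiff
      (hg.injective_differential x.1.1) (hg.2 x.1.1)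
  · exact (isPolarAt_polarMap hg x).meanCurvatureVector_eq_zero hg.contMDiff hf
      (hg.injective_differential x.1.1) (hg.2 x.1.1)

theorem rMeanCurvature_polarMap_eq_zero (hg : IsMinimalImmersion 2 g) {r : ℕ} (hr : 2 < r)
    (x : starBundle g) {ν : E6} :
    letI := starBundleChartedSpace hg
    ν ∈ normalSpace 4 (polarMap g) x → rMeanCurvature 4 r (polarMap g) x ν = 0 := by
  let := starBundleChartedSpace hg
  exact (isPolarAt_polarMap hg x).rMeanCurvature_eq_zero hg.contMDiff (contMDiff_polarMap hg)
    (hg.injective_differential x.1.1) (hg.2 x.1.1) hr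

end PolarMap

end SphereImmersion

theorem theorem1_general {M : Type*} [TopologicalSpace M]
    [ChartedSpace (EuclideanSpace ℝ (Fin 2)) M] [IsManifold (𝓡 2) ∞ M] (g : M → S5)
    (hg : IsMinimalImmersion 2 g) :
    IsOpen {q : unitNormalBundle g | (q : M × E6) ∈ starBundle g} ∧
    ∃ _ : ChartedSpace (EuclideanSpace ℝ (Fin 4)) (starBundle g),
      IsManifold (𝓡 4) ∞ (starBundle g) ∧
      Manifold.IsSmoothEmbedding (𝓡 4) ((𝓡 2).prod 𝓘(ℝ, E6)) ∞
        (Subtype.val : starBundle g → M × E6) ∧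
      IsMinimalImmersion 4 (polarMap g) ∧
      ∀ (q : starBundle g) (ν : E6), ‖ν‖ = 1 → ν ∈ normalSpace 4 (polarMap g) q →
        gaussKroneckerCurvature 4 (polarMap g) q ν = 0 ∧
        rMeanCurvature 4 3 (polarMap g) q ν = 0 :=
  ⟨isOpen_starBundle hg.contMDiff, starBundleChartedSpace hg,
    SubmanifoldChart.isManifold _ (mem_source_starBundleChart hg),
    SubmanifoldChart.isSmoothEmbedding_val _ (mem_source_starBundleChart hg) (by simp),
    isMinimalImmersion_polarMap hg,
    fun q _ _ hν => ⟨rMeanCurvature_polarMap_eq_zero hg (by norm_num) q hν,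
      rMeanCurvature_polarMap_eq_zero hg (by norm_num) q hν⟩⟩

theorem theorem1 {M : Type*} [TopologicalSpace M] [ChartedSpace (EuclideanSpace ℝ (Fin 2)) M]
    [IsManifold (𝓡 2) ∞ M] (g : M → S5) (hg : IsMinimalImmersion 2 g)
    (hB : ∀ p : M, ∃ X Y : TangentSpace (𝓡 2) p, secondFundamentalForm 2 g p X Y ≠ 0) :
    -- `N_*` is open in `N`
    IsOpen {q : unitNormalBundle g | (q : M × E6) ∈ starBundle g} ∧
    -- `N_*` is a smooth four-dimensional embedded submanifold of `M × ℝ⁶`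
    ∃ _ : ChartedSpace (EuclideanSpace ℝ (Fin 4)) (starBundle g),
      IsManifold (𝓡 4) ∞ (starBundle g) ∧
      Manifold.IsSmoothEmbedding (𝓡 4) ((𝓡 2).prod 𝓘(ℝ, E6)) ∞
        (Subtype.val : starBundle g → M × E6) ∧
      -- for this structure `x_g` is a minimal immersion into `S⁵`
      IsMinimalImmersion 4 (polarMap g) ∧
      -- with vanishing Gauss–Kronecker and 3-mean curvatures (for either unit normal)
      ∀ (q : starBundle g) (ν : E6), ‖ν‖ = 1 → ν ∈ normalSpace 4 (polarMap g) q →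
        gaussKroneckerCurvature 4 (polarMap g) q ν = 0 ∧
        rMeanCurvature 4 3 (polarMap g) q ν = 0 :=
  theorem1_general g hg
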